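/- Let $\mathfrak g$ be a finite-dimensional complex semisimple Lie algebra with a nondegenerate symmetric invariant bilinear form $\langle\cdot,\cdot\rangle$. Fix a Cartan subalgebra $\mathfrak h$ and a system of simple roots, and let $\mathfrak n_\pm$ be the sums of the positive (negative) root spaces, $\mathfrak b_\pm=\mathfrak h\oplus\mathfrak n_\pm$. Let $t=t_0+t_1+t_2\in\mathfrak g\otimes\mathfrak g$ be the tensor corresponding to the form, with $t_0\in\mathfrak h\otimes\mathfrak h$, $t_1\in\mathfrak n_+\otimes\mathfrak n_-$, $t_2\in\mathfrak n_-\otimes\mathfrak n_+$; put $r=\frac12t_0+t_1$, and let $r_{sym}$, $r_{alt}$ be its symmetric and skew-symmetric parts, with components $r^{\mu\nu}$, $r_{sym}^{\mu\nu}$, $r_{alt}^{\mu\nu}$ in a basis $\{e_\mu\}$ of $\mathfrak g$. Let $\bar G$ be the group of all automorphisms of $\mathfrak g$ that preserve $\langle\cdot,\cdot\rangle$ and are the identity on the center of $\mathfrak g$, and let $G=\operatorname{Int}\mathfrak g\subset\bar G$ be the group of inner automorphisms. On either group let $\partial_\mu$ (resp. $\partial'_\mu$) be the right-invariant (resp.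 left-invariant) vector field corresponding to $e_\mu$. Equip $G$ with the Sklyanin bracket $\{\phi,\psi\}=r^{\mu\nu}(\partial'_\mu\phi\,\partial'_\nu\psi-\partial_\mu\phi\,\partial_\nu\psi)$, and let $X$ be $\bar G$ equipped with the bracket of regular functions $$\{\phi,\psi\}=-r_{alt}^{\mu\nu}(\partial'_\mu\phi-\partial_\mu\phi)(\partial'_\nu\psi-\partial_\nu\psi)+r_{sym}^{\mu\nu}(\partial'_\mu\phi-\partial_\mu\phi)(\partial'_\nu\psi+\partial_\nu\psi).$$ Equip $\mathfrak g\times\mathfrak g$ with the scalar product $\langle(x_1,y_1),(x_2,y_2)\rangle=\langle x_1,x_2\rangle-\langle y_1,y_2\rangle$, let $\mathfrak g$ be embedded diagonally, and identify $\mathfrak g^*$, by means of this scalar product, with $\mathfrak m=\{(x,y)\in\mathfrak b_-\times\mathfrak b_+ : x_{\mathfrak h}+y_{\mathfrak h}=0\}$. A point $s$ of a Poisson homogeneous $G$-space $S$ (a Poisson variety with a transitive Poisson action of the Poisson-Lie group $G$) corresponds to $$\mathfrak l_s=\{a+\xi : a\in\mathfrak g,\ \xi\in\mathfrak k^\perp\subset\mathfrak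 g^*,\ (\xi\otimes1)\pi(s)=a \bmod \mathfrak k\},$$ where $\mathfrak k$ is the Lie algebra of the stabilizer of $s$ and $\pi(s)\in\bigwedge^2(\mathfrak g/\mathfrak k)=\bigwedge^2T_sS$ is the value of the Poisson bivector. Then: 1. The bracket on $X$ is a Poisson bracket. 2. $G$ with the Sklyanin bracket is a Poisson-Lie group, and its action on $X$ by conjugations is Poisson, i.e. $G\times X\to X$ is a Poisson map. 3. Every $G$-orbit $O\subset X$ carries a Poisson structure for which the inclusion $O\to X$ is a Poisson map and $O$ is a Poisson homogeneous $G$-space. The subset of $\mathfrak g\times\mathfrak g$ that corresponds to a point $g\in O$ is $\mathfrak l_g=\{(x,y) : x=g(y)\}$, and $\mathfrak l_g$ is a Lagrangian subalgebra (a subalgebra that is a maximal isotropic subspace). -/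

import Mathlib

namespace PoissonHom
open NormedSpace
open scoped Matrix TensorProduct

noncomputable section

/-! Facts on the matrix exponential, used to see that `exp (ad x)` is an automorphism. -/

section MatrixExponential
attribute [local instance] Matrix.linftyOpNormedRing Matrix.linftyOpNormedAlgebra

theorem hasDerivAt_mulVec {n : Type*} [Fintype n] [DecidableEq n]
    {A : ℂ → Matrix n n ℂ} {u : ℂ → n → ℂ} {A' : Matrix n n ℂ} {u' : n → ℂ} {t : ℂ}
    (hA : HasDerivAt A A' t) (hu : HasDerivAt u u' t) :
    HasDerivAt (fun s => A s *ᵥ u s) (A t *ᵥ u' + A' *ᵥ u t) t :=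
  (Matrix.mulVecBilin ℂ ℂ :
    Matrix n n ℂ →ₗ[ℂ] (n → ℂ) →ₗ[ℂ] n → ℂ).toContinuousBilinearMap.hasDerivAt_of_bilinear (fun _ => hA) (fun _ => hu)

theorem hasDerivAt_exp_mulVec {n : Type*} [Fintype n] [DecidableEq n] (M : Matrix n n ℂ)
    (u : n → ℂ) (t : ℂ) :
    HasDerivAt (fun s : ℂ => exp (s • M) *ᵥ u) (M *ᵥ (exp (t • M) *ᵥ u)) t := by
  have h := hasDerivAt_mulVec (hasDerivAt_exp_smul_const' (𝕂 := ℂ) M t) (hasDerivAt_const t u)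
  rw [Matrix.mulVec_zero, zero_add, ← Matrix.mulVec_mulVec] at h
  exact h

theorem exp_mulVec_bilin {n m : Type*} [Fintype n] [DecidableEq n] [Fintype m] [DecidableEq m]
    (M : Matrix n n ℂ) (N : Matrix m m ℂ) (β : (n → ℂ) →ₗ[ℂ] (n → ℂ) →ₗ[ℂ] (m → ℂ))
    (h : ∀ u v, N *ᵥ β u v = β (M *ᵥ u) v + β u (M *ᵥ v)) (u v : n → ℂ) :
    exp N *ᵥ β u v = β (exp M *ᵥ u) (exp M *ᵥ v) := by
  have key : ∀ t : ℂ, HasDerivAt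
      (fun s : ℂ => exp (s • (-N)) *ᵥ (β (exp (s • M) *ᵥ u) (exp (s • M) *ᵥ v))) 0 t := by
    intro t
    have h1 := hasDerivAt_exp_smul_const (𝕂 := ℂ) (-N) t
    have hb := β.toContinuousBilinearMap.hasDerivAt_of_bilinear
      (fun _ => hasDerivAt_exp_mulVec M u t) (fun _ => hasDerivAt_exp_mulVec M v t)
    simp only [LinearMap.toContinuousBilinearMap_apply] at hb
    refine (hasDerivAt_mulVec h1 hb).congr_deriv ?_
    rw [← Matrix.mulVec_mulVec, ← Matrix.mulVec_add, Matrix.neg_mulVec, h]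
    rw [add_comm, add_comm (β (exp (t • M) *ᵥ u) _), neg_add_cancel, Matrix.mulVec_zero]
  have hconst := is_const_of_deriv_eq_zero (fun t => (key t).differentiableAt)
    (fun t => (key t).deriv) 1 0
  simp only [one_smul, zero_smul, exp_zero, Matrix.one_mulVec] at hconst
  rw [← hconst, Matrix.mulVec_mulVec, ← Matrix.exp_add_of_commute _ _ (Commute.refl N).neg_right]
  simp

end MatrixExponential

/-! ### The exponential of an endomorphism -/

/-- The exponential of an endomorphism of a finite-dimensional complex vector space,
computed as a matrix exponential in some basis. -/
def endExp {V : Type*} [AddCommGroup V] [Module ℂ V] [FiniteDimensional ℂ V]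
    (A : Module.End ℂ V) : Module.End ℂ V :=
  (LinearMap.toMatrixAlgEquiv (Module.finBasis ℂ V)).symm
    (exp (LinearMap.toMatrixAlgEquiv (Module.finBasis ℂ V) A))

theorem repr_toMatrix {V : Type*} [AddCommGroup V] [Module ℂ V] [FiniteDimensional ℂ V]
    (A : Module.End ℂ V) (v : V) :
    (Module.finBasis ℂ V).equivFun (A v) =
      LinearMap.toMatrixAlgEquiv (Module.finBasis ℂ V) A *ᵥ
        (Module.finBasis ℂ V).equivFun v :=
  (LinearMap.toMatrix_mulVec_repr (Module.finBasis ℂ V) (Module.finBasis ℂ V) A v).symm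

theorem endExp_repr {V : Type*} [AddCommGroup V] [Module ℂ V] [FiniteDimensional ℂ V]
    (A : Module.End ℂ V) (v : V) :
    (Module.finBasis ℂ V).equivFun (endExp A v) =
      exp (LinearMap.toMatrixAlgEquiv (Module.finBasis ℂ V) A) *ᵥ
        (Module.finBasis ℂ V).equivFun v := by
  rw [repr_toMatrix, endExp, AlgEquiv.apply_symm_apply]

theorem endExp_bilin {V W : Type*} [AddCommGroup V] [Module ℂ V] [FiniteDimensional ℂ V]
    [AddCommGroup W] [Module ℂ W] [FiniteDimensional ℂ W]
    (A : Module.End ℂ V) (C : Module.End ℂ W) (β : V →ₗ[ℂ] V →ₗ[ℂ] W)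
    (h : ∀ u v, C (β u v) = β (A u) v + β u (A v)) (u v : V) :
    endExp C (β u v) = β (endExp A u) (endExp A v) := by
  let bV := (Module.finBasis ℂ V).equivFun
  let bW := (Module.finBasis ℂ W).equivFun
  let γ := (β.compl₁₂ bV.symm.toLinearMap bV.symm.toLinearMap).compr₂ bW.toLinearMap
  have hγ : ∀ x y, γ x y = bW (β (bV.symm x) (bV.symm y)) := fun x y => rfl
  have key := exp_mulVec_bilin (LinearMap.toMatrixAlgEquiv (Module.finBasis ℂ V) A)
    (LinearMap.toMatrixAlgEquiv (Module.finBasis ℂ W) C) γ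
    (by
      intro x y
      obtain ⟨x, rfl⟩ := bV.surjective x
      obtain ⟨y, rfl⟩ := bV.surjective y
      rw [← repr_toMatrix, ← repr_toMatrix]
      simp only [hγ, LinearEquiv.symm_apply_apply]
      rw [← repr_toMatrix, h, map_add]
      simp only [bV, bW, LinearEquiv.symm_apply_apply])
    (bV u) (bV v)
  rw [← endExp_repr, ← endExp_repr] at key
  simp only [hγ, LinearEquiv.symm_apply_apply] at key
  rw [← endExp_repr] at key
  apply bW.injective
  simpa only [bV, bW, LinearEquiv.symm_apply_apply] using key

theorem endExp_mul_neg {V : Type*} [AddCommGroup V] [Module ℂ V] [FiniteDimensional ℂ V]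
    (A : Module.End ℂ V) : endExp A * endExp (-A) = 1 := by
  have h : Commute (LinearMap.toMatrixAlgEquiv (Module.finBasis ℂ V) A)
      (-LinearMap.toMatrixAlgEquiv (Module.finBasis ℂ V) A) := (Commute.refl _).neg_right
  rw [endExp, endExp, ← map_mul, map_neg, ← Matrix.exp_add_of_commute _ _ h]
  simp

theorem endExp_zero {V : Type*} [AddCommGroup V] [Module ℂ V] [FiniteDimensional ℂ V] :
    endExp (0 : Module.End ℂ V) = 1 := by
  simp [endExp]

/-! ### Regular functions and Poisson brackets

A (locally closed, smooth) subvariety of a finite-dimensional complex vector space `V` is given by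
an injective map `ι : S → V`; its structure is recorded by the algebra of regular functions. -/

/-- The algebra of polynomial functions on a complex vector space. -/
def polynomialFunctions (V : Type*) [AddCommGroup V] [Module ℂ V] : Subalgebra ℂ (V → ℂ) :=
  Algebra.adjoin ℂ (Set.range fun l : Module.Dual ℂ V => (l : V → ℂ))

/-- The algebra of regular functions on `S`, embedded in the vector space `V` by `ι`: the
functions that, near every point in the Zariski topology, are quotients of polynomials. -/
def regularFunctions {S V : Type*} [AddCommGroup V] [Module ℂ V] (ι : S → V) :
    Subalgebra ℂ (S → ℂ) where
  carrier := {φ | ∀ p : S, ∃ a ∈ polynomialFunctions V, ∃ q ∈ polynomialFunctions V,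
    q (ι p) ≠ 0 ∧ ∀ s : S, q (ι s) ≠ 0 → φ s = a (ι s) / q (ι s)}
  mul_mem' := by
    intro φ ψ hφ hψ p
    obtain ⟨a, ha, q, hq, hp, h⟩ := hφ p
    obtain ⟨a', ha', q', hq', hp', h'⟩ := hψ p
    refine ⟨a * a', mul_mem ha ha', q * q', mul_mem hq hq', mul_ne_zero hp hp', ?_⟩
    intro s hs
    simp only [Pi.mul_apply] at hs ⊢
    rw [h s (left_ne_zero_of_mul hs), h' s (right_ne_zero_of_mul hs), div_mul_div_comm]
  add_mem' := by
    intro φ ψ hφ hψ p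
    obtain ⟨a, ha, q, hq, hp, h⟩ := hφ p
    obtain ⟨a', ha', q', hq', hp', h'⟩ := hψ p
    refine ⟨a * q' + q * a', add_mem (mul_mem ha hq') (mul_mem hq ha'), q * q', mul_mem hq hq',
      mul_ne_zero hp hp', ?_⟩
    intro s hs
    simp only [Pi.mul_apply, Pi.add_apply] at hs ⊢
    rw [h s (left_ne_zero_of_mul hs), h' s (right_ne_zero_of_mul hs),
      div_add_div _ _ (left_ne_zero_of_mul hs) (right_ne_zero_of_mul hs)]
  algebraMap_mem' := by
    intro c p
    exact ⟨algebraMap ℂ _ c, Subalgebra.algebraMap_mem _ c, 1, one_mem _, one_ne_zero,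
      fun s _ => by simp⟩

/-- A bracket of functions on `S`. Only its values on regular functions matter. -/
abbrev FunBracket (S : Type*) := (S → ℂ) → (S → ℂ) → (S → ℂ)

/-- `br` is a Poisson bracket on the algebra `A` of functions on `S`: it maps `A × A` to `A`, and
is bilinear, skew-symmetric, a derivation in each argument, and satisfies the Jacobi identity.

For a smooth quasi-affine variety `S` with algebra `A` of regular functions, this is the same as a
Poisson structure on `S`: the bracket extends uniquely to the sheaf of regular functions. -/
structure IsPoissonBracket {S : Type*} (A : Subalgebra ℂ (S → ℂ)) (br : FunBracket S) :
    Prop where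
  mem : ∀ φ ∈ A, ∀ ψ ∈ A, br φ ψ ∈ A
  add_left : ∀ φ ∈ A, ∀ ψ ∈ A, ∀ χ ∈ A, br (φ + ψ) χ = br φ χ + br ψ χ
  smul_left : ∀ c : ℂ, ∀ φ ∈ A, ∀ ψ ∈ A, br (c • φ) ψ = c • br φ ψ
  skew : ∀ φ ∈ A, ∀ ψ ∈ A, br φ ψ = -br ψ φ
  leibniz : ∀ φ ∈ A, ∀ ψ ∈ A, ∀ χ ∈ A, br φ (ψ * χ) = br φ ψ * χ + ψ * br φ χ
  jacobi : ∀ φ ∈ A, ∀ ψ ∈ A, ∀ χ ∈ A,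
    br φ (br ψ χ) + br ψ (br χ φ) + br χ (br φ ψ) = 0

/-- `f : S → T` is a Poisson map: a regular map such that pull-back of functions preserves the
brackets. -/
structure IsPoissonMap {S T : Type*} (A : Subalgebra ℂ (S → ℂ)) (br : FunBracket S)
    (A' : Subalgebra ℂ (T → ℂ)) (br' : FunBracket T) (f : S → T) : Prop where
  regular : ∀ φ ∈ A', φ ∘ f ∈ A
  bracket : ∀ φ ∈ A', ∀ ψ ∈ A', br' φ ψ ∘ f = br (φ ∘ f) (ψ ∘ f)

/-- The bracket of the product of two Poisson varieties. -/
def prodBracket {S T : Type*} (br : FunBracket S) (br' : FunBracket T) : FunBracket (S × T) :=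
  fun Φ Ψ p => br (fun s => Φ (s, p.2)) (fun s => Ψ (s, p.2)) p.1 +
    br' (fun t => Φ (p.1, t)) (fun t => Ψ (p.1, t)) p.2

/-- The group `K`, embedded in `V` by `κ`, is a Poisson-Lie group with the bracket `brK`:
`brK` is a Poisson bracket and the multiplication `K × K → K` is a Poisson map. -/
structure IsPoissonLieGroup {K V : Type*} [Group K] [AddCommGroup V] [Module ℂ V] (κ : K → V)
    (brK : FunBracket K) : Prop where
  poisson : IsPoissonBracket (regularFunctions κ) brK
  mul : IsPoissonMap (regularFunctions (Prod.map κ κ)) (prodBracket brK brK)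
    (regularFunctions κ) brK (fun p : K × K => p.1 * p.2)

/-- The action of the Poisson-Lie group `K` on the Poisson variety `S` is Poisson:
the map `K × S → S` is Poisson. -/
structure IsPoissonAction {K V S W : Type*} [Group K] [AddCommGroup V] [Module ℂ V]
    [AddCommGroup W] [Module ℂ W] [MulAction K S] (κ : K → V) (brK : FunBracket K)
    (ι : S → W) (br : FunBracket S) : Prop where
  group : IsPoissonLieGroup κ brK
  poisson : IsPoissonBracket (regularFunctions ι) br
  act : IsPoissonMap (regularFunctions (Prod.map κ ι)) (prodBracket brK br)
    (regularFunctions ι) br (fun p : K × S => p.1 • p.2)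

/-- A Poisson homogeneous space: a Poisson variety with a transitive Poisson action. -/
structure IsPoissonHomogeneousSpace {K V S W : Type*} [Group K] [AddCommGroup V] [Module ℂ V]
    [AddCommGroup W] [Module ℂ W] [MulAction K S] (κ : K → V) (brK : FunBracket K)
    (ι : S → W) (br : FunBracket S) : Prop where
  action : IsPoissonAction κ brK ι br
  transitive : MulAction.IsPretransitive K S

/-! ### Invariant vector fields and the action on functions -/

section VectorFields

variable {g K S : Type*} [AddCommGroup g] [Module ℂ g] [Group K] [MulAction K S]

/-- The derivative of `φ` along the right-invariant vector field on the group `K` that corresponds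
to `x`; here `ex` is the exponential map of `K`. -/
def rightInv (ex : g → K) (x : g) (φ : K → ℂ) (k : K) : ℂ :=
  deriv (fun t : ℂ => φ (ex (t • x) * k)) 0

/-- The derivative of `φ` along the left-invariant vector field that corresponds to `x`. -/
def leftInv (ex : g → K) (x : g) (φ : K → ℂ) (k : K) : ℂ :=
  deriv (fun t : ℂ => φ (k * ex (t • x))) 0

/-- The derivative at `s` of `φ` along the orbit map `k ↦ k • s` in the direction of `x`; in other
words, the value at `x` of the pull-back of the covector `dφ` at `s` to the Lie algebra. -/
def orbitDeriv (ex : g → K) (s : S) (φ : S → ℂ) (x : g) : ℂ :=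
  deriv (fun t : ℂ => φ (ex (t • x) • s)) 0

/-- The Lie algebra of the stabilizer of `s`. -/
def stabilizerLie (ex : g → K) (s : S) : Set g := {x | ∀ t : ℂ, ex (t • x) • s = s}

end VectorFields

/-! ### The Lie algebra, its form, and the automorphism groups -/

section LieTheory

variable {g : Type*} [LieRing g] [LieAlgebra ℂ g]

variable (g) in
/-- A nondegenerate symmetric invariant bilinear form on `g`. -/
structure InvariantForm where
  form : LinearMap.BilinForm ℂ g
  nondegenerate : form.Nondegenerate
  symm : form.IsSymm
  invariant : form.lieInvariant g

/-- The natural scalar product on the double `g × g`. -/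
def doubleForm (B : InvariantForm g) (p q : g × g) : ℂ := B.form p.1 q.1 - B.form p.2 q.2

/-- `W` is isotropic in the double `g × g`. -/
def IsIsotropic (B : InvariantForm g) (W : Submodule ℂ (g × g)) : Prop :=
  ∀ p ∈ W, ∀ q ∈ W, doubleForm B p q = 0

/-- A Lagrangian subalgebra of the double: a subalgebra that is a maximal isotropic subspace. -/
def IsLagrangian (B : InvariantForm g) (L : LieSubalgebra ℂ (g × g)) : Prop :=
  Maximal (IsIsotropic B) L.toSubmodule

/-- The group of all automorphisms of the Lie algebra `g` that preserve the form and are equal to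
the identity on the center of `g`. -/
def Gbar (B : InvariantForm g) : Subgroup (g ≃ₗ[ℂ] g) where
  carrier := {σ | (∀ x y, σ ⁅x, y⁆ = ⁅σ x, σ y⁆) ∧ (∀ x y, B.form (σ x) (σ y) = B.form x y) ∧
    ∀ z ∈ LieAlgebra.center ℂ g, σ z = z}
  mul_mem' := by
    rintro σ τ ⟨h1, h2, h3⟩ ⟨k1, k2, k3⟩
    refine ⟨fun x y => ?_, fun x y => ?_, fun z hz => ?_⟩
    · simp only [LinearEquiv.mul_apply, k1, h1]
    · simp only [LinearEquiv.mul_apply, h2, k2]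
    · simp only [LinearEquiv.mul_apply, k3 z hz, h3 z hz]
  one_mem' := ⟨fun _ _ => rfl, fun _ _ => rfl, fun _ _ => rfl⟩
  inv_mem' := by
    rintro σ ⟨h1, h2, h3⟩
    have e : ∀ x, σ (σ⁻¹ x) = x := fun x => σ.apply_symm_apply x
    refine ⟨fun x y => ?_, fun x y => ?_, fun z hz => ?_⟩
    · apply σ.injective
      rw [h1, e, e, e]
    · rw [← h2, e, e]
    · apply σ.injective
      rw [e, h3 z hz]

variable [FiniteDimensional ℂ g] [LieAlgebra.IsSemisimple ℂ g]

/-- The element `exp (ad x)` of the group `Gbar B`. -/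
def expAd (B : InvariantForm g) (x : g) : Gbar B :=
  ⟨LinearEquiv.ofLinearMap (endExp (LieAlgebra.ad ℂ g x)) (endExp (-LieAlgebra.ad ℂ g x))
    (endExp_mul_neg _) (by
      have h := endExp_mul_neg (-LieAlgebra.ad ℂ g x)
      rwa [neg_neg] at h), by
    refine ⟨fun y z => ?_, fun y z => ?_, fun z hz => ?_⟩
    · exact endExp_bilin (LieAlgebra.ad ℂ g x) (LieAlgebra.ad ℂ g x)
        (LieModule.toEnd ℂ g g : g →ₗ[ℂ] Module.End ℂ g) (fun u v => leibniz_lie x u v) y z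
    · have h := endExp_bilin (LieAlgebra.ad ℂ g x) (0 : Module.End ℂ ℂ) B.form (fun u v => by
        have := B.invariant x u v
        simp only [LieAlgebra.ad_apply, LinearMap.zero_apply]
        rw [this, neg_add_cancel]) y z
      rw [endExp_zero] at h
      exact h.symm
    · have hz' : z = 0 := by
        have := LieAlgebra.center_eq_bot (R := ℂ) (L := g)
        rw [this] at hz
        simpa using hz
      rw [hz', map_zero]⟩

/-- The group `Int g` of inner automorphisms, generated by all `exp (ad x)`, as a subgroup of
`Gbar B`. -/
def IntG (B : InvariantForm g) : Subgroup (Gbar B) := Subgroup.closure (Set.range (expAd B))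

/-- The exponential map `g → Int g`. -/
def expInt (B : InvariantForm g) (x : g) : IntG B :=
  ⟨expAd B x, Subgroup.subset_closure ⟨x, rfl⟩⟩

/-- The variety `X`: the group `Gbar B`, on which `Int g` acts by conjugations. -/
def X (B : InvariantForm g) : Type _ := Gbar B

instance conjAction (B : InvariantForm g) : MulAction (IntG B) (X B) where
  smul h x := ((h : Gbar B) * (show Gbar B from x) * (h : Gbar B)⁻¹ : Gbar B)
  one_smul x := by
    have h : ∀ y : Gbar B, (1 : Gbar B) * y * (1 : Gbar B)⁻¹ = y := fun y => by simp
    exact h x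
  mul_smul h k x := by
    have hk : ∀ a b y : Gbar B, a * b * y * (a * b)⁻¹ = a * (b * y * b⁻¹) * a⁻¹ :=
      fun a b y => by group
    exact hk h k x

/-- The embedding of `X` into the vector space of endomorphisms of `g`. -/
def embX (B : InvariantForm g) (x : X B) : Module.End ℂ g :=
  (((show Gbar B from x) : g ≃ₗ[ℂ] g) : g →ₗ[ℂ] g)

/-- The embedding of `Int g` into the vector space of endomorphisms of `g`. -/
def embInt (B : InvariantForm g) (h : IntG B) : Module.End ℂ g :=
  (((h : Gbar B) : g ≃ₗ[ℂ] g) : g →ₗ[ℂ] g)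

/-- The embedding of the orbit of a point of `X` into the endomorphisms of `g`. -/
def embOrbit (B : InvariantForm g) (x : X B) (y : MulAction.orbit (IntG B) x) : Module.End ℂ g :=
  embX B y

/-- The subalgebra `{(x, y) | x = σ y}` of `g × g` attached to `σ`. -/
def graphSubalgebra (B : InvariantForm g) (σ : X B) : LieSubalgebra ℂ (g × g) where
  carrier := {p | p.1 = embX B σ p.2}
  add_mem' := by
    intro p q hp hq
    simp only [Set.mem_ofPred_eq] at hp hq ⊢
    rw [Prod.fst_add, Prod.snd_add, map_add, hp, hq]
  zero_mem' := by simp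
  smul_mem' := by
    intro c p hp
    simp only [Set.mem_ofPred_eq] at hp ⊢
    rw [Prod.smul_fst, Prod.smul_snd, map_smul, hp]
  lie_mem' := by
    intro p q hp hq
    change ⁅p.1, q.1⁆ = embX B σ ⁅p.2, q.2⁆
    have hp' : p.1 = embX B σ p.2 := hp
    have hq' : q.1 = embX B σ q.2 := hq
    rw [hp', hq']
    exact ((show Gbar B from σ).2.1 p.2 q.2).symm

/-! ### The triangular decomposition and the tensor `r` -/

section Triangular

variable (H : LieSubalgebra ℂ g) [H.IsCartanSubalgebra]

/-- The sum of the weight spaces of `H` in `g` for the weights in `s`. -/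
def weightSum (s : Set (LieModule.Weight ℂ H g)) : Submodule ℂ g :=
  ⨆ χ ∈ s, (LieModule.genWeightSpace g χ : LieSubmodule ℂ H g).toSubmodule

set_option linter.unusedSectionVars false in
theorem weightSum_isCompl (s : Set (LieModule.Weight ℂ H g)) :
    IsCompl (weightSum H s) (weightSum H sᶜ) := by
  have hind : iSupIndep fun χ : LieModule.Weight ℂ H g =>
      (LieModule.genWeightSpace g χ : LieSubmodule ℂ H g).toSubmodule :=
    LieSubmodule.iSupIndep_toSubmodule.mpr (LieModule.iSupIndep_genWeightSpace' ℂ H g)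
  refine ⟨hind.disjoint_biSup_biSup disjoint_compl_right, codisjoint_iff.mpr ?_⟩
  rw [weightSum, weightSum, ← iSup_union, Set.union_compl_self]
  simp only [Set.mem_univ, iSup_pos]
  rw [← LieSubmodule.iSup_toSubmodule, LieModule.iSup_genWeightSpace_eq_top',
    LieSubmodule.top_toSubmodule]

/-- The projection of `g` onto `weightSum H s` along the other weight spaces. -/
def weightProj (s : Set (LieModule.Weight ℂ H g)) : g →ₗ[ℂ] g :=
  (weightSum H s).projection (weightSum H sᶜ) (weightSum_isCompl H s)

/-- The zero weight, whose weight space is `H` itself. -/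
def zeroWeights : Set (LieModule.Weight ℂ H g) := {χ | χ.IsZero}

variable {H} (Γ : (LieAlgebra.IsKilling.rootSystem H).Base)

/-- The positive roots with respect to the system `Γ` of simple roots. -/
def posRoots : Set (LieModule.Weight ℂ H g) := {χ | ∃ h : χ ∈ H.root, Γ.IsPos ⟨χ, h⟩}

/-- The negative roots. -/
def negRoots : Set (LieModule.Weight ℂ H g) := {χ | -χ ∈ posRoots Γ}

/-- The Borel subalgebra `𝔟₊ = 𝔥 ⊕ 𝔫₊` (as a subspace). -/
def bPlus : Submodule ℂ g := H.toSubmodule ⊔ weightSum H (posRoots Γ)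

/-- The Borel subalgebra `𝔟₋ = 𝔥 ⊕ 𝔫₋` (as a subspace). -/
def bMinus : Submodule ℂ g := H.toSubmodule ⊔ weightSum H (negRoots Γ)

/-- The complement `𝔪 = {(x, y) ∈ 𝔟₋ × 𝔟₊ | x_𝔥 + y_𝔥 = 0}` of the diagonal in the Manin triple
`(g × g, g_diag, 𝔪)`. -/
def maninComplement : Set (g × g) :=
  {p | p.1 ∈ bMinus Γ ∧ p.2 ∈ bPlus Γ ∧
    weightProj H (zeroWeights H) p.1 + weightProj H (zeroWeights H) p.2 = 0}

/-- The tensor `t ∈ g ⊗ g` that corresponds to the form: `t = ∑ eᵢ ⊗ eⁱ` for dual bases. -/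
def casimirTensor (B : InvariantForm g) : g ⊗[ℂ] g :=
  ∑ i, Module.finBasis ℂ g i ⊗ₜ[ℂ]
    (B.form.dualBasis B.nondegenerate (Module.finBasis ℂ g)) i

/-- The tensor `r = ½ t₀ + t₁`, where `t₀` and `t₁` are the components of `t` in `𝔥 ⊗ 𝔥` and in
`𝔫₊ ⊗ 𝔫₋`. -/
def rTensor (B : InvariantForm g) : g ⊗[ℂ] g :=
  (1 / 2 : ℂ) • TensorProduct.map (weightProj H (zeroWeights H)) (weightProj H (zeroWeights H))
      (casimirTensor B) +
    TensorProduct.map (weightProj H (posRoots Γ)) (weightProj H (negRoots Γ)) (casimirTensor B)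

/-- The symmetric part of `r`. -/
def rSym (B : InvariantForm g) : g ⊗[ℂ] g :=
  (1 / 2 : ℂ) • (rTensor Γ B + TensorProduct.comm ℂ g g (rTensor Γ B))

/-- The skew-symmetric part of `r`. -/
def rAlt (B : InvariantForm g) : g ⊗[ℂ] g :=
  (1 / 2 : ℂ) • (rTensor Γ B - TensorProduct.comm ℂ g g (rTensor Γ B))

/-- The components of a tensor in a basis. -/
def comp {ι : Type*} (e : Module.Basis ι ℂ g) (τ : g ⊗[ℂ] g) (μ ν : ι) : ℂ :=
  (e.tensorProduct e).repr τ (μ, ν)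

/-! ### The brackets -/

variable {ι : Type*} [Fintype ι] (e : Module.Basis ι ℂ g)

/-- Sklyanin's bracket on `Int g`. -/
def sklyaninBracket (B : InvariantForm g) : FunBracket (IntG B) := fun φ ψ h =>
  ∑ μ, ∑ ν, comp e (rTensor Γ B) μ ν *
    (leftInv (expInt B) (e μ) φ h * leftInv (expInt B) (e ν) ψ h -
      rightInv (expInt B) (e μ) φ h * rightInv (expInt B) (e ν) ψ h)

/-- The bracket on `Gbar B` that makes it the Poisson variety `X`. -/
def bracketGbar (B : InvariantForm g) : FunBracket (Gbar B) := fun φ ψ x =>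
  -(∑ μ, ∑ ν, comp e (rAlt Γ B) μ ν *
      (leftInv (expAd B) (e μ) φ x - rightInv (expAd B) (e μ) φ x) *
      (leftInv (expAd B) (e ν) ψ x - rightInv (expAd B) (e ν) ψ x)) +
    (∑ μ, ∑ ν, comp e (rSym Γ B) μ ν *
      (leftInv (expAd B) (e μ) φ x - rightInv (expAd B) (e μ) φ x) *
      (leftInv (expAd B) (e ν) ψ x + rightInv (expAd B) (e ν) ψ x))

/-- The bracket of `X`. -/
def bracketX (B : InvariantForm g) : FunBracket (X B) := bracketGbar Γ e B

/-- The subset of the double `g × g` that corresponds to a point `s` of a Poisson homogeneous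
`Int g`-space `S`. With `𝔨` the Lie algebra of the stabilizer of `s`, so that `T_s S = g / 𝔨`, and
`π ∈ ⋀² (g / 𝔨)` the value at `s` of the Poisson bivector, it is
`{a + ξ | a ∈ g, ξ ∈ 𝔨^⊥ ⊆ g*, (ξ ⊗ 1) π = a mod 𝔨}`. Here `g` is the diagonal of `g × g` and
`g* = 𝔪` by means of the scalar product of `g × g`. Covectors at `s` are differentials of regular
functions `φ`, so that `ξ` is the pull-back of `dφ` along the orbit map, and the last condition
says that `{φ, ψ}(s)` is the derivative of `ψ` at `s` in the direction of `a`, for all `ψ`. -/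
def correspondingSubset (B : InvariantForm g) {S W : Type*} [AddCommGroup W] [Module ℂ W]
    [MulAction (IntG B) S] (j : S → W) (br : FunBracket S) (s : S) : Set (g × g) :=
  {p | ∃ a : g, ∃ m ∈ maninComplement Γ, p = (a, a) + m ∧
    (∀ b ∈ stabilizerLie (expInt B) s, doubleForm B m (b, b) = 0) ∧
    ∃ φ ∈ regularFunctions j,
      (∀ b : g, orbitDeriv (expInt B) s φ b = doubleForm B m (b, b)) ∧
      ∀ ψ ∈ regularFunctions j, br φ ψ s = orbitDeriv (expInt B) s ψ a}

end Triangular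

end LieTheory

end

end PoissonHom

/-!
All brackets are treated as restrictions of brackets on one vector space. The double `g × g` acts on
`W = Module.End ℂ g` by the linear vector fields `A ↦ A ∘ ad x - ad y ∘ A`, and a tensor
`∑ aᵢ ⊗ bᵢ` on the double defines the bracket `{F, G} = ∑ (aᵢ F) (bᵢ G)` of analytic functions
on `W`. If the tensor satisfies the classical Yang–Baxter equation and its symmetric part vanishes
at the points of a subvariety, then any bracket of functions on the subvariety that can be computed
with local extensions to `W` is Poisson (`fieldBracket_jacobi`, `IsRestriction.isPoissonBracket`).

With an invariant scalar product, a tensor becomes an operator `R`; if `R + R* = 1`, the Yang–Baxter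
equation is the Rota–Baxter identity for `R` (`yangBaxter_of_rotaBaxter`). The tensor `r` on `g`
corresponds to `ρ = ½ P₀ + P₋`, whose Rota–Baxter identity is checked on weight vectors
(`rOp_rotaBaxter`). On the double, Sklyanin's bracket comes from `ρ × ρ`, and the bracket of `X`
from the projection `(x, y) ↦ (z - ρ z, -ρ z)`, `z = x - y`, along the diagonal onto a complementary
Lagrangian subalgebra. The symmetric parts of both tensors are halves of the Casimir tensor of the
double. It vanishes on the group, since there the gradients of functions have the form `(u, σ u)`
(`exists_gradient`), and these vectors are isotropic.

The left factors of the tensor for `X` span the diagonal, which acts by the infinitesimal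
conjugations. So the Hamiltonian vector fields are tangent to the orbits, and the bracket of `X`
restricts to them. Conjugation by `h` changes the tensor by `r - (h ⊗ h) r`, which is compensated by
Sklyanin's bivector at `h`; this makes the action Poisson. Finally, if the differential of `φ` on
the orbit of `σ` is represented by an element `m` of the Manin complement, the Hamiltonian vector
field of `φ` is given by `(m.2, m.1)`. It agrees with the action of `a ∈ g` precisely if the pair
`(a + m.2, a + m.1)` acts trivially at `σ`, that is, if `a + m` is in the graph of `σ`
(`IsConjugationSpace.correspondingSubset_eq`).
-/

namespace PoissonHom
open NormedSpace
open scoped Matrix TensorProduct Topology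

noncomputable section

set_option linter.unusedSectionVars false

/-! ### The classical Yang–Baxter equation -/

section YangBaxter

variable {d I : Type*} [LieRing d] [LieAlgebra ℂ d] [Fintype I]

/-- The contraction of the tensor `∑ aᵢ ⊗ bᵢ` with two functionals. -/
def contract (a b : I → d) (Φ Ψ : Module.Dual ℂ d) : ℂ := ∑ i, Φ (a i) * Ψ (b i)

/-- The classical Yang–Baxter equation `[r₁₂, r₁₃] + [r₁₂, r₂₃] + [r₁₃, r₂₃] = 0` for
`r = ∑ aᵢ ⊗ bᵢ`, tested against all triples of functionals. -/
def YangBaxter (a b : I → d) : Prop := ∀ Φ Ψ Χ : Module.Dual ℂ d,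
  ∑ i, ∑ j, (Φ ⁅a i, a j⁆ * Ψ (b i) * Χ (b j) + Φ (a i) * Ψ ⁅b i, a j⁆ * Χ (b j) +
    Φ (a i) * Ψ (a j) * Χ ⁅b i, b j⁆) = 0

/-- If the operator `R` attached to `r = ∑ aᵢ ⊗ bᵢ` by an invariant scalar product satisfies
`R + R* = 1`, then the classical Yang–Baxter equation for `r` is the Rota–Baxter identity
for `R`. -/
theorem yangBaxter_of_rotaBaxter (T : LinearMap.BilinForm ℂ d)
    (hT : ∀ Φ : Module.Dual ℂ d, ∃ u, ∀ x, Φ x = T u x) (hsymm : ∀ x y, T x y = T y x)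
    (hinv : ∀ x y z : d, T ⁅x, y⁆ z = -T y ⁅x, z⁆) (R : d →ₗ[ℂ] d)
    (hR : ∀ x y : d, ⁅R x, R y⁆ = R (⁅R x, y⁆ + ⁅x, R y⁆ - ⁅x, y⁆))
    (hadj : ∀ x y, T (R x) y = T x (y - R y)) (a b : I → d)
    (h₁ : ∀ u, ∑ i, T u (a i) • b i = R u) (h₂ : ∀ v, ∑ i, T v (b i) • a i = v - R v) :
    YangBaxter a b := by
  intro Φ Ψ Χ
  obtain ⟨u, hu⟩ := hT Φ
  obtain ⟨v, hv⟩ := hT Ψ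
  obtain ⟨w, hw⟩ := hT Χ
  have e₁ : ∑ i, ∑ j, Φ ⁅a i, a j⁆ * Ψ (b i) * Χ (b j) = T u ⁅v - R v, w - R w⁆ := by
    rw [← h₂ v, ← h₂ w, sum_lie_sum]
    simp only [hu, hv, hw, map_sum, lie_smul, smul_lie, map_smul, smul_eq_mul]
    refine Finset.sum_congr rfl fun i _ => Finset.sum_congr rfl fun j _ => by ring
  have e₂ : ∑ i, ∑ j, Φ (a i) * Ψ ⁅b i, a j⁆ * Χ (b j) = T v ⁅R u, w - R w⁆ := by
    rw [← h₁ u, ← h₂ w, sum_lie_sum]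
    simp only [hu, hv, hw, map_sum, lie_smul, smul_lie, map_smul, smul_eq_mul]
    refine Finset.sum_congr rfl fun i _ => Finset.sum_congr rfl fun j _ => by ring
  have e₃ : ∑ i, ∑ j, Φ (a i) * Ψ (a j) * Χ ⁅b i, b j⁆ = T w ⁅R u, R v⁆ := by
    rw [← h₁ u, ← h₁ v, sum_lie_sum]
    simp only [hu, hv, hw, map_sum, lie_smul, smul_lie, map_smul, smul_eq_mul]
    refine Finset.sum_congr rfl fun i _ => Finset.sum_congr rfl fun j _ => by ring
  simp only [Finset.sum_add_distrib, e₁, e₂, e₃]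
  -- All three terms are moved to the form `T _ w`.
  have i₁ : T u ⁅v - R v, w - R w⁆ = T (R ⁅u, v - R v⁆) w := by
    rw [hadj, ← lie_skew u, map_neg, LinearMap.neg_apply, hinv, neg_neg]
  have i₂ : T v ⁅R u, w - R w⁆ = T (R ⁅v, R u⁆) w := by
    rw [hadj, ← lie_skew v, map_neg, LinearMap.neg_apply, hinv, neg_neg]
  rw [i₁, i₂, hsymm w, hR, ← LinearMap.add_apply, ← LinearMap.add_apply, ← map_add, ← map_add,
    ← map_add, ← map_add]
  have : ⁅u, v - R v⁆ + ⁅v, R u⁆ + (⁅R u, v⁆ + ⁅u, R v⁆ - ⁅u, v⁆) = 0 := by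
    rw [lie_sub, ← lie_skew v (R u)]; abel
  rw [this, map_zero, map_zero, LinearMap.zero_apply]

end YangBaxter

/-! ### Brackets defined by linear vector fields -/

section Fields

variable {d W I : Type*} [LieRing d] [LieAlgebra ℂ d] [NormedAddCommGroup W] [NormedSpace ℂ W]
  [Fintype I]

/-- The pull-back to `d` of the differential of `F` at `w`, where `z ∈ d` acts on `W` by the linear
vector field `w ↦ M z w`. -/
def pullDeriv (M : d →ₗ[ℂ] W →L[ℂ] W) (F : W → ℂ) (w : W) : Module.Dual ℂ d where
  toFun z := fderiv ℂ F w (M z w)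
  map_add' z z' := by simp
  map_smul' c z := by simp

variable {M : d →ₗ[ℂ] W →L[ℂ] W}

theorem pullDeriv_apply (F : W → ℂ) (w : W) (z : d) :
    pullDeriv M F w z = fderiv ℂ F w (M z w) := rfl

theorem analyticAt_pullDeriv {F : W → ℂ} {w : W} (hF : AnalyticAt ℂ F w) (z : d) :
    AnalyticAt ℂ (fun v => pullDeriv M F v z) w :=
  ((ContinuousLinearMap.apply ℂ ℂ).analyticAt_bilinear (M z w, fderiv ℂ F w)).comp₂
    ((M z).analyticAt w) hF.fderiv

theorem pullDeriv_congr {F G : W → ℂ} {w : W} (h : F =ᶠ[𝓝 w] G) :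
    pullDeriv M F w = pullDeriv M G w := by
  ext z
  rw [pullDeriv_apply, pullDeriv_apply, h.fderiv_eq]

theorem pullDeriv_add {F G : W → ℂ} {w : W} (hF : AnalyticAt ℂ F w) (hG : AnalyticAt ℂ G w) :
    pullDeriv M (F + G) w = pullDeriv M F w + pullDeriv M G w := by
  ext z
  simp [pullDeriv_apply, fderiv_add hF.differentiableAt hG.differentiableAt]

theorem pullDeriv_neg (F : W → ℂ) (w : W) :
    pullDeriv M (-F) w = -pullDeriv M F w := by
  ext z
  simp [pullDeriv_apply, fderiv_neg]

theorem pullDeriv_smul (c : ℂ) {F : W → ℂ} {w : W} (hF : AnalyticAt ℂ F w) :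
    pullDeriv M (c • F) w = c • pullDeriv M F w := by
  ext z
  simp [pullDeriv_apply, fderiv_const_smul hF.differentiableAt]

theorem pullDeriv_mul {F G : W → ℂ} {w : W} (hF : AnalyticAt ℂ F w) (hG : AnalyticAt ℂ G w) :
    pullDeriv M (F * G) w = G w • pullDeriv M F w + F w • pullDeriv M G w := by
  ext z
  simp [pullDeriv_apply, fderiv_mul hF.differentiableAt hG.differentiableAt, add_comm]

theorem pullDeriv_sum {J : Type*} (s : Finset J) {F : J → W → ℂ} {w : W}
    (hF : ∀ j ∈ s, AnalyticAt ℂ (F j) w) :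
    pullDeriv M (fun v => ∑ j ∈ s, F j v) w = ∑ j ∈ s, pullDeriv M (F j) w := by
  ext z
  rw [pullDeriv_apply, fderiv_fun_sum fun j hj => (hF j hj).differentiableAt]
  simp [pullDeriv_apply]

theorem pullDeriv_div {F G : W → ℂ} {w : W} (hF : AnalyticAt ℂ F w) (hG : AnalyticAt ℂ G w)
    (hw : G w ≠ 0) (z : d) : pullDeriv M (F / G) w z =
      (pullDeriv M F w z * G w - F w * pullDeriv M G w z) / (G w * G w) := by
  have h := pullDeriv_mul (M := M) (hF.div hG hw) hG
  have e : F / G * G =ᶠ[𝓝 w] F := by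
    filter_upwards [hG.continuousAt.eventually_ne hw] with v hv
    simp [hv]
  rw [pullDeriv_congr e] at h
  rw [h]
  simp only [LinearMap.add_apply, LinearMap.smul_apply, smul_eq_mul, Pi.div_apply]
  field_simp
  ring

/-- The vector fields of an anti-homomorphism `M` from `d` to the linear maps of `W` form a Lie
algebra action. -/
theorem pullDeriv_commutator
    (hM : ∀ z z' w, M ⁅z, z'⁆ w = M z' (M z w) - M z (M z' w)) {F : W → ℂ} {w : W}
    (hF : AnalyticAt ℂ F w) (z z' : d) :
    pullDeriv M (fun v => pullDeriv M F v z') w z - pullDeriv M (fun v => pullDeriv M F v z) w z' =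
      pullDeriv M F w ⁅z, z'⁆ := by
  have key : ∀ x y : d, pullDeriv M (fun v => pullDeriv M F v y) w x =
      fderiv ℂ (fderiv ℂ F) w (M x w) (M y w) + fderiv ℂ F w (M y (M x w)) := by
    intro x y
    have h := (hF.fderiv.differentiableAt.hasFDerivAt).clm_apply ((M y).hasFDerivAt (x := w))
    have h' : fderiv ℂ (fun v => pullDeriv M F v y) w = _ := h.fderiv
    rw [pullDeriv_apply, h']
    simp [add_comm]
  have hs : IsSymmSndFDerivAt ℂ F w :=
    (hF.contDiffAt (n := ⊤)).isSymmSndFDerivAt (by simp)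
  rw [key, key, pullDeriv_apply, hM, map_sub, hs.eq (M z w) (M z' w)]
  ring

/-- The bracket `{F, G} = ∑ (aᵢ F) (bᵢ G)` of functions on `W`, with `d` acting by linear vector
fields. -/
def fieldBracket (M : d →ₗ[ℂ] W →L[ℂ] W) (a b : I → d) (F G : W → ℂ) (w : W) : ℂ :=
  contract a b (pullDeriv M F w) (pullDeriv M G w)

theorem analyticAt_fieldBracket {a b : I → d} {F G : W → ℂ} {w : W}
    (hF : AnalyticAt ℂ F w) (hG : AnalyticAt ℂ G w) :
    AnalyticAt ℂ (fieldBracket M a b F G) w := by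
  have : fieldBracket M a b F G =
      ∑ i, (fun v => pullDeriv M F v (a i)) * fun v => pullDeriv M G v (b i) := by
    ext v
    simp [fieldBracket, contract]
  rw [this]
  exact Finset.analyticAt_sum _ fun i _ =>
    (analyticAt_pullDeriv hF _).mul (analyticAt_pullDeriv hG _)

theorem pullDeriv_fieldBracket {a b : I → d} {F G : W → ℂ} {w : W}
    (hF : AnalyticAt ℂ F w) (hG : AnalyticAt ℂ G w) (z : d) :
    pullDeriv M (fieldBracket M a b F G) w z =
      ∑ i, (pullDeriv M (fun v => pullDeriv M F v (a i)) w z * pullDeriv M G w (b i) +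
        pullDeriv M F w (a i) * pullDeriv M (fun v => pullDeriv M G v (b i)) w z) := by
  have : fieldBracket M a b F G =
      fun v => ∑ i, ((fun v => pullDeriv M F v (a i)) * fun v => pullDeriv M G v (b i)) v := by
    ext v
    simp [fieldBracket, contract]
  rw [this, pullDeriv_sum _ fun i _ => (analyticAt_pullDeriv hF _).mul (analyticAt_pullDeriv hG _),
    LinearMap.sum_apply]
  refine Finset.sum_congr rfl fun i _ => ?_
  rw [pullDeriv_mul (analyticAt_pullDeriv hF _) (analyticAt_pullDeriv hG _)]
  simp only [LinearMap.add_apply, LinearMap.smul_apply, smul_eq_mul]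
  ring

/-- The Jacobi identity, in Leibniz form, at a point where the symmetric part of `∑ aᵢ ⊗ bᵢ` acts
trivially. The terms with second derivatives combine to commutators, except for those of `F`, where
the vanishing of the symmetric part has to be used first; what remains is the Yang–Baxter
expression. -/
theorem fieldBracket_jacobi (hM : ∀ z z' w, M ⁅z, z'⁆ w = M z' (M z w) - M z (M z' w))
    {a b : I → d} (hr : YangBaxter a b) {F G K : W → ℂ} {w : W}
    (hF : AnalyticAt ℂ F w) (hG : AnalyticAt ℂ G w) (hK : AnalyticAt ℂ K w)
    (hskew : ∀ F G : W → ℂ, fieldBracket M a b F G w = -fieldBracket M a b G F w) :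
    fieldBracket M a b F (fieldBracket M a b G K) w =
      fieldBracket M a b G (fieldBracket M a b F K) w +
        fieldBracket M a b (fieldBracket M a b F G) K w := by
  have cF := pullDeriv_commutator hM hF
  have cG := pullDeriv_commutator hM hG
  have cK := pullDeriv_commutator hM hK
  have hc : ∀ j, ∑ i, pullDeriv M G w (a i) * pullDeriv M (fun v => pullDeriv M F v (a j)) w (b i) =
      -∑ i, pullDeriv M G w (b i) * pullDeriv M (fun v => pullDeriv M F v (a j)) w (a i) := by
    intro j
    have := hskew G (fun v => pullDeriv M F v (a j))
    simp only [fieldBracket, contract] at this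
    simpa only [mul_comm] using this
  have hyb := hr (pullDeriv M F w) (pullDeriv M G w) (pullDeriv M K w)
  simp only [← cF, ← cG, ← cK, mul_sub, sub_mul, Finset.sum_add_distrib,
    Finset.sum_sub_distrib] at hyb
  have hS : ∑ i, ∑ j, pullDeriv M G w (a i) * pullDeriv M (fun v => pullDeriv M F v (a j)) w (b i) *
      pullDeriv M K w (b j) = -∑ i, ∑ j, pullDeriv M (fun v => pullDeriv M F v (a j)) w (a i) *
        pullDeriv M G w (b i) * pullDeriv M K w (b j) := by
    rw [Finset.sum_comm, Finset.sum_comm (f := fun i j =>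
      pullDeriv M (fun v => pullDeriv M F v (a j)) w (a i) * pullDeriv M G w (b i) *
        pullDeriv M K w (b j)), ← Finset.sum_neg_distrib]
    refine Finset.sum_congr rfl fun j _ => ?_
    rw [← Finset.sum_mul, hc, ← Finset.sum_mul, neg_mul]
    simp only [mul_comm]
  have e₁ : fieldBracket M a b F (fieldBracket M a b G K) w =
      ∑ i, pullDeriv M F w (a i) * pullDeriv M (fieldBracket M a b G K) w (b i) := rfl
  have e₂ : fieldBracket M a b G (fieldBracket M a b F K) w =
      ∑ i, pullDeriv M G w (a i) * pullDeriv M (fieldBracket M a b F K) w (b i) := rfl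
  have e₃ : fieldBracket M a b (fieldBracket M a b F G) K w =
      ∑ i, pullDeriv M (fieldBracket M a b F G) w (a i) * pullDeriv M K w (b i) := rfl
  simp only [pullDeriv_fieldBracket hF hG, pullDeriv_fieldBracket hF hK,
    pullDeriv_fieldBracket hG hK, Finset.mul_sum, Finset.sum_mul, mul_add, add_mul,
    Finset.sum_add_distrib, ← mul_assoc] at e₁ e₂ e₃
  rw [e₁, e₂, e₃]
  rw [hS, Finset.sum_comm (f := fun i j => pullDeriv M G w (a i) * pullDeriv M F w (a j) *
      pullDeriv M (fun v => pullDeriv M K v (b j)) w (b i)),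
    Finset.sum_comm (f := fun i j => pullDeriv M (fun v => pullDeriv M F v (a j)) w (a i) *
      pullDeriv M G w (b j) * pullDeriv M K w (b i)),
    Finset.sum_comm (f := fun i j => pullDeriv M F w (a j) *
      pullDeriv M (fun v => pullDeriv M G v (b j)) w (a i) * pullDeriv M K w (b i))]
  simp only [mul_comm (pullDeriv M G w (a _)) (pullDeriv M F w (a _))] at hyb ⊢
  linear_combination hyb

end Fields

/-! ### Polynomial maps and regular functions -/

section Regular

variable {V V' S S' : Type*} [AddCommGroup V] [Module ℂ V] [AddCommGroup V'] [Module ℂ V']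

theorem dual_mem_polynomialFunctions (l : Module.Dual ℂ V) :
    (l : V → ℂ) ∈ polynomialFunctions V := Algebra.subset_adjoin ⟨l, rfl⟩

/-- A map of vector spaces is polynomial if its composite with every linear form is. -/
def IsPolynomialMap (f : V' → V) : Prop :=
  ∀ l : Module.Dual ℂ V, (fun v => l (f v)) ∈ polynomialFunctions V'

theorem isPolynomialMap_linear (f : V' →ₗ[ℂ] V) : IsPolynomialMap f := fun l =>
  dual_mem_polynomialFunctions (l ∘ₗ f)

theorem isPolynomialMap_fst : IsPolynomialMap (Prod.fst : V × V' → V) :=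
  isPolynomialMap_linear (LinearMap.fst ℂ V V')

theorem isPolynomialMap_snd : IsPolynomialMap (Prod.snd : V × V' → V') :=
  isPolynomialMap_linear (LinearMap.snd ℂ V V')

theorem IsPolynomialMap.bilin {U E : Type*} [AddCommGroup U] [Module ℂ U] [AddCommGroup E]
    [Module ℂ E] [FiniteDimensional ℂ U] {f : V' → U} {h : V' → V} (hf : IsPolynomialMap f)
    (hh : IsPolynomialMap h) (β : U →ₗ[ℂ] V →ₗ[ℂ] E) :
    IsPolynomialMap fun v => β (f v) (h v) := by
  intro l
  have : (fun v => l (β (f v) (h v))) = ∑ i, (fun v => (Module.finBasis ℂ U).coord i (f v)) *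
      fun v => (l ∘ₗ β (Module.finBasis ℂ U i)) (h v) := by
    ext v
    have := congrArg (fun u => l (β u (h v))) ((Module.finBasis ℂ U).sum_repr (f v))
    refine this.symm.trans ?_
    simp only [map_sum, LinearMap.sum_apply, map_smul, LinearMap.smul_apply]
    simp
  rw [this]
  exact sum_mem fun i _ => mul_mem (hf _) (hh _)

theorem IsPolynomialMap.mul {E : Type*} [AddCommGroup E] [Module ℂ E] [FiniteDimensional ℂ E]
    {f h : V' → Module.End ℂ E} (hf : IsPolynomialMap f) (hh : IsPolynomialMap h) :
    IsPolynomialMap fun v => f v * h v :=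
  hf.bilin hh (LinearMap.mul ℂ (Module.End ℂ E))

theorem comp_mem_polynomialFunctions {f : V' → V} (hf : IsPolynomialMap f) {a : V → ℂ}
    (ha : a ∈ polynomialFunctions V) : a ∘ f ∈ polynomialFunctions V' := by
  induction ha using Algebra.adjoin_induction with
  | mem x hx => obtain ⟨l, rfl⟩ := hx; exact hf l
  | algebraMap r => exact Subalgebra.algebraMap_mem _ r
  | add x y _ _ h h' => exact add_mem h h'
  | mul x y _ _ h h' => exact mul_mem h h'

theorem comp_mem_regularFunctions {κ : S' → V'} {ι : S → V} {f : V' → V}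
    (hf : IsPolynomialMap f) {m : S' → S} (hm : ∀ s, ι (m s) = f (κ s)) {φ : S → ℂ}
    (hφ : φ ∈ regularFunctions ι) : φ ∘ m ∈ regularFunctions κ := by
  intro p
  obtain ⟨a, ha, q, hq, h0, h⟩ := hφ (m p)
  refine ⟨a ∘ f, comp_mem_polynomialFunctions hf ha, q ∘ f, comp_mem_polynomialFunctions hf hq,
    ?_, fun s hs => ?_⟩
  · simpa [hm] using h0
  · have := h (m s) (by simpa [hm] using hs)
    simpa [hm] using this

theorem regularFunctions_comp_equiv (c : V ≃ₗ[ℂ] V') (ι : S → V) :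
    regularFunctions (c ∘ ι) = regularFunctions ι := by
  apply le_antisymm
  · intro φ hφ
    exact comp_mem_regularFunctions (ι := c ∘ ι) (m := id) (isPolynomialMap_linear c.toLinearMap)
      (fun _ => rfl) hφ
  · intro φ hφ
    exact comp_mem_regularFunctions (κ := c ∘ ι) (m := id)
      (isPolynomialMap_linear c.symm.toLinearMap)
      (fun s => by simp) hφ

theorem comp_mem_regularFunctions_of_polynomial (ι : S → V) {a : V → ℂ}
    (ha : a ∈ polynomialFunctions V) : a ∘ ι ∈ regularFunctions ι := fun _ =>
  ⟨a, ha, 1, one_mem _, one_ne_zero, fun _ _ => by simp⟩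

end Regular

/-! ### Poisson brackets on embedded varieties -/

section Local

variable {d W I S : Type*} [LieRing d] [LieAlgebra ℂ d] [NormedAddCommGroup W] [NormedSpace ℂ W]
  [Fintype I]

/-- `F` is an analytic function near `ι s` which restricts to `φ` near `s`. -/
structure IsLocalExt (ι : S → W) (φ : S → ℂ) (s : S) (F : W → ℂ) : Prop where
  analytic : AnalyticAt ℂ F (ι s)
  eventually : ∀ᶠ w in 𝓝 (ι s), ∀ t, ι t = w → φ t = F w

variable {ι : S → W} {φ ψ : S → ℂ} {s : S} {F G : W → ℂ} {M : d →ₗ[ℂ] W →L[ℂ] W} {a b : I → d}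

theorem IsLocalExt.eventually_isLocalExt (h : IsLocalExt ι φ s F) :
    ∀ᶠ w in 𝓝 (ι s), ∀ t, ι t = w → IsLocalExt ι φ t F := by
  filter_upwards [h.analytic.eventually_analyticAt, h.eventually.eventually_nhds] with w h₁ h₂
  rintro t rfl
  exact ⟨h₁, h₂⟩

theorem IsLocalExt.eq (h : IsLocalExt ι φ s F) : φ s = F (ι s) :=
  h.eventually.self_of_nhds s rfl

theorem IsLocalExt.add (h : IsLocalExt ι φ s F) (h' : IsLocalExt ι ψ s G) :
    IsLocalExt ι (φ + ψ) s (F + G) := by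
  refine ⟨h.analytic.add h'.analytic, ?_⟩
  filter_upwards [h.eventually, h'.eventually] with w h₁ h₂ t ht
  simp [h₁ t ht, h₂ t ht]

theorem IsLocalExt.mul (h : IsLocalExt ι φ s F) (h' : IsLocalExt ι ψ s G) :
    IsLocalExt ι (φ * ψ) s (F * G) := by
  refine ⟨h.analytic.mul h'.analytic, ?_⟩
  filter_upwards [h.eventually, h'.eventually] with w h₁ h₂ t ht
  simp [h₁ t ht, h₂ t ht]

theorem IsLocalExt.smul (c : ℂ) (h : IsLocalExt ι φ s F) : IsLocalExt ι (c • φ) s (c • F) := by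
  refine ⟨h.analytic.const_smul, ?_⟩
  filter_upwards [h.eventually] with w h₁ t ht
  simp [h₁ t ht]

theorem IsLocalExt.neg (h : IsLocalExt ι φ s F) : IsLocalExt ι (-φ) s (-F) := by
  refine ⟨h.analytic.neg, ?_⟩
  filter_upwards [h.eventually] with w h₁ t ht
  simp [h₁ t ht]

section

variable [FiniteDimensional ℂ W]

theorem analyticAt_dual (l : Module.Dual ℂ W) (w : W) : AnalyticAt ℂ (l : W → ℂ) w :=
  (LinearMap.toContinuousLinearMap l).analyticAt w

theorem pullDeriv_dual (l : Module.Dual ℂ W) (w : W) (z : d) :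
    pullDeriv M (l : W → ℂ) w z = l (M z w) := by
  have : fderiv ℂ (l : W → ℂ) w = LinearMap.toContinuousLinearMap l :=
    (LinearMap.toContinuousLinearMap l).fderiv
  rw [pullDeriv_apply, this]
  rfl

theorem analyticAt_of_mem_polynomialFunctions {p : W → ℂ} (hp : p ∈ polynomialFunctions W)
    (w : W) : AnalyticAt ℂ p w := by
  induction hp using Algebra.adjoin_induction with
  | mem x hx => obtain ⟨l, rfl⟩ := hx; exact analyticAt_dual l w
  | algebraMap r => exact analyticAt_const
  | add x y _ _ h h' => exact h.add h'
  | mul x y _ _ h h' => exact h.mul h'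

theorem pullDeriv_mem_polynomialFunctions {p : W → ℂ} (hp : p ∈ polynomialFunctions W)
    (z : d) : (fun w => pullDeriv M p w z) ∈ polynomialFunctions W := by
  induction hp using Algebra.adjoin_induction with
  | mem x hx =>
    obtain ⟨l, rfl⟩ := hx
    simp only [pullDeriv_dual]
    exact dual_mem_polynomialFunctions (l ∘ₗ (M z : W →ₗ[ℂ] W))
  | algebraMap r =>
    have : (fun w => pullDeriv M (algebraMap ℂ (W → ℂ) r) w z) = 0 := by
      ext w
      rw [pullDeriv_apply]
      have : fderiv ℂ (algebraMap ℂ (W → ℂ) r) w = 0 := fderiv_const_apply r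
      simp [this]
    rw [this]
    exact zero_mem _
  | add x y hx hy h h' =>
    have : (fun w => pullDeriv M (x + y) w z) =
        (fun w => pullDeriv M x w z) + fun w => pullDeriv M y w z := by
      ext w
      simp [pullDeriv_add (analyticAt_of_mem_polynomialFunctions hx w)
        (analyticAt_of_mem_polynomialFunctions hy w)]
    rw [this]
    exact add_mem h h'
  | mul x y hx hy h h' =>
    have : (fun w => pullDeriv M (x * y) w z) =
        y * (fun w => pullDeriv M x w z) + x * fun w => pullDeriv M y w z := by
      ext w
      simp [pullDeriv_mul (analyticAt_of_mem_polynomialFunctions hx w)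
        (analyticAt_of_mem_polynomialFunctions hy w)]
    rw [this]
    exact add_mem (mul_mem hy h) (mul_mem hx h')

/-- A quotient of polynomials that represents a function near a point in the Zariski topology is a
local extension at all points where its denominator does not vanish. -/
theorem isLocalExt_div {p q : W → ℂ} (hp : p ∈ polynomialFunctions W)
    (hq : q ∈ polynomialFunctions W) (h : ∀ t, q (ι t) ≠ 0 → φ t = p (ι t) / q (ι t))
    (hs : q (ι s) ≠ 0) : IsLocalExt ι φ s (p / q) := by
  have hq' := analyticAt_of_mem_polynomialFunctions hq (ι s)
  refine ⟨(analyticAt_of_mem_polynomialFunctions hp _).div hq' hs, ?_⟩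
  filter_upwards [hq'.continuousAt.eventually_ne hs] with w hw
  rintro t rfl
  exact h t hw

theorem exists_isLocalExt (hφ : φ ∈ regularFunctions ι) (s : S) : ∃ F, IsLocalExt ι φ s F := by
  obtain ⟨p, hp, q, hq, h0, h⟩ := hφ s
  exact ⟨p / q, isLocalExt_div hp hq h h0⟩

end

/-- The bracket `br` on `S` is the restriction of the bracket `∑ (aᵢ F) (bᵢ G)` on `W`. -/
def IsRestriction (M : d →ₗ[ℂ] W →L[ℂ] W) (a b : I → d) (ι : S → W) (br : FunBracket S) : Prop :=
  ∀ φ ψ s F G, IsLocalExt ι φ s F → IsLocalExt ι ψ s G →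
    br φ ψ s = fieldBracket M a b F G (ι s)

theorem IsRestriction.isLocalExt {br : FunBracket S} (hbr : IsRestriction M a b ι br)
    (h : IsLocalExt ι φ s F) (h' : IsLocalExt ι ψ s G) :
    IsLocalExt ι (br φ ψ) s (fieldBracket M a b F G) := by
  refine ⟨analyticAt_fieldBracket h.analytic h'.analytic, ?_⟩
  filter_upwards [h.eventually_isLocalExt, h'.eventually_isLocalExt] with w h₁ h₂
  rintro t rfl
  exact hbr _ _ _ _ _ (h₁ t rfl) (h₂ t rfl)

theorem exists_fieldBracket_div_eq [FiniteDimensional ℂ W] {p q p' q' : W → ℂ}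
    (hp : p ∈ polynomialFunctions W) (hq : q ∈ polynomialFunctions W)
    (hp' : p' ∈ polynomialFunctions W) (hq' : q' ∈ polynomialFunctions W) :
    ∃ n ∈ polynomialFunctions W, ∀ w, q w ≠ 0 → q' w ≠ 0 →
      fieldBracket M a b (p / q) (p' / q') w = n w / (q * q * (q' * q')) w := by
  refine ⟨∑ i, ((fun w => pullDeriv M p w (a i)) * q - p * fun w => pullDeriv M q w (a i)) *
    ((fun w => pullDeriv M p' w (b i)) * q' - p' * fun w => pullDeriv M q' w (b i)), ?_, ?_⟩
  · refine sum_mem fun i _ => mul_mem (sub_mem (mul_mem ?_ hq) (mul_mem hp ?_))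
      (sub_mem (mul_mem ?_ hq') (mul_mem hp' ?_)) <;>
    apply pullDeriv_mem_polynomialFunctions <;> assumption
  · intro w hw hw'
    have A := fun {r : W → ℂ} (hr : r ∈ polynomialFunctions W) =>
      analyticAt_of_mem_polynomialFunctions hr w
    simp only [fieldBracket, contract, pullDeriv_div (A hp) (A hq) hw,
      pullDeriv_div (A hp') (A hq') hw', Finset.sum_apply, Pi.mul_apply, Pi.sub_apply,
      Finset.sum_div, div_mul_div_comm]

/-- The bracket attached to a solution of the classical Yang–Baxter equation is a Poisson bracket on
every subvariety along which the symmetric part of the solution acts trivially, as soon as it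
restricts to functions on the subvariety. -/
theorem IsRestriction.isPoissonBracket [FiniteDimensional ℂ W] {br : FunBracket S}
    (hbr : IsRestriction M a b ι br)
    (hM : ∀ z z' w, M ⁅z, z'⁆ w = M z' (M z w) - M z (M z' w)) (hr : YangBaxter a b)
    (hskew : ∀ (s : S) (F G : W → ℂ),
      fieldBracket M a b F G (ι s) = -fieldBracket M a b G F (ι s)) :
    IsPoissonBracket (regularFunctions ι) br := by
  have skew : ∀ φ ∈ regularFunctions ι, ∀ ψ ∈ regularFunctions ι, br φ ψ = -br ψ φ := by
    intro φ hφ ψ hψ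
    ext s
    obtain ⟨F, hF⟩ := exists_isLocalExt hφ s
    obtain ⟨G, hG⟩ := exists_isLocalExt hψ s
    rw [Pi.neg_apply, hbr _ _ _ _ _ hF hG, hbr _ _ _ _ _ hG hF, hskew]
  constructor
  · intro φ hφ ψ hψ s
    obtain ⟨p, hp, q, hq, h0, h⟩ := hφ s
    obtain ⟨p', hp', q', hq', h0', h'⟩ := hψ s
    obtain ⟨n, hn, hn'⟩ := exists_fieldBracket_div_eq (M := M) (a := a) (b := b) hp hq hp' hq'
    refine ⟨n, hn, q * q * (q' * q'), mul_mem (mul_mem hq hq) (mul_mem hq' hq'), by simp [*], ?_⟩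
    intro t ht
    have ht₁ : q (ι t) ≠ 0 := fun h => ht (by simp [h])
    have ht₂ : q' (ι t) ≠ 0 := fun h => ht (by simp [h])
    rw [← hn' _ ht₁ ht₂]
    exact hbr _ _ _ _ _ (isLocalExt_div hp hq h ht₁) (isLocalExt_div hp' hq' h' ht₂)
  · intro φ hφ ψ hψ χ hχ
    ext s
    obtain ⟨F, hF⟩ := exists_isLocalExt hφ s
    obtain ⟨G, hG⟩ := exists_isLocalExt hψ s
    obtain ⟨K, hK⟩ := exists_isLocalExt hχ s
    rw [Pi.add_apply, hbr _ _ _ _ _ (hF.add hG) hK, hbr _ _ _ _ _ hF hK, hbr _ _ _ _ _ hG hK]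
    simp [fieldBracket, contract, pullDeriv_add hF.analytic hG.analytic, add_mul,
      Finset.sum_add_distrib]
  · intro c φ hφ ψ hψ
    ext s
    obtain ⟨F, hF⟩ := exists_isLocalExt hφ s
    obtain ⟨G, hG⟩ := exists_isLocalExt hψ s
    rw [Pi.smul_apply, hbr _ _ _ _ _ (hF.smul c) hG, hbr _ _ _ _ _ hF hG]
    simp [fieldBracket, contract, pullDeriv_smul c hF.analytic, Finset.mul_sum, mul_assoc]
  · exact skew
  · intro φ hφ ψ hψ χ hχ
    ext s
    obtain ⟨F, hF⟩ := exists_isLocalExt hφ s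
    obtain ⟨G, hG⟩ := exists_isLocalExt hψ s
    obtain ⟨K, hK⟩ := exists_isLocalExt hχ s
    rw [Pi.add_apply, Pi.mul_apply, Pi.mul_apply, hbr _ _ _ _ _ hF (hG.mul hK),
      hbr _ _ _ _ _ hF hK, hbr _ _ _ _ _ hF hG, hG.eq, hK.eq]
    simp only [fieldBracket, contract, pullDeriv_mul hG.analytic hK.analytic,
      LinearMap.add_apply, LinearMap.smul_apply, smul_eq_mul, Finset.mul_sum, Finset.sum_mul]
    rw [← Finset.sum_add_distrib]
    exact Finset.sum_congr rfl fun i _ => by ring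
  · intro φ hφ ψ hψ χ hχ
    ext s
    obtain ⟨F, hF⟩ := exists_isLocalExt hφ s
    obtain ⟨G, hG⟩ := exists_isLocalExt hψ s
    obtain ⟨K, hK⟩ := exists_isLocalExt hχ s
    have hJ := fieldBracket_jacobi hM hr hF.analytic hG.analytic hK.analytic (hskew s)
    rw [skew χ hχ φ hφ]
    simp only [Pi.add_apply, Pi.zero_apply]
    rw [hbr _ _ _ _ _ hF (hbr.isLocalExt hG hK), hbr _ _ _ _ _ hG (hbr.isLocalExt hF hK).neg,
      hbr _ _ _ _ _ hK (hbr.isLocalExt hF hG), hJ, hskew s K]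
    simp [fieldBracket, contract, pullDeriv_neg]

end Local

/-! ### The Rota–Baxter operator of a triangular decomposition -/

section Triangular

open LieAlgebra LieModule

variable {g : Type*} [LieRing g] [LieAlgebra ℂ g] [FiniteDimensional ℂ g]
  [LieAlgebra.IsSemisimple ℂ g] {H : LieSubalgebra ℂ g} [H.IsCartanSubalgebra]
  {Γ : (LieAlgebra.IsKilling.rootSystem H).Base} {χ χ₁ χ₂ : Weight ℂ H g}

theorem mem_weightSum {s : Set (Weight ℂ H g)} (hχ : χ ∈ s) {x : g}
    (hx : x ∈ genWeightSpace g χ) : x ∈ weightSum H s :=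
  (le_biSup (fun χ : Weight ℂ H g => (genWeightSpace g χ : LieSubmodule ℂ H g).toSubmodule) hχ :
    _ ≤ weightSum H s) hx

theorem weightProj_apply_of_mem {s : Set (Weight ℂ H g)} (hχ : χ ∈ s) {x : g}
    (hx : x ∈ genWeightSpace g χ) : weightProj H s x = x :=
  Submodule.projection_apply_of_mem_left _ (mem_weightSum hχ hx)

theorem weightProj_apply_of_notMem {s : Set (Weight ℂ H g)} (hχ : χ ∉ s) {x : g}
    (hx : x ∈ genWeightSpace g χ) : weightProj H s x = 0 :=
  (Submodule.projection_apply_eq_zero_iff _).2 (mem_weightSum (Set.mem_compl hχ) hx)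

theorem exists_weightProj_eq_smul (s : Set (Weight ℂ H g)) {x : g}
    (hx : x ∈ genWeightSpace g χ) : ∃ c : ℂ, weightProj H s x = c • x := by
  by_cases h : χ ∈ s
  · exact ⟨1, by rw [weightProj_apply_of_mem h hx, one_smul]⟩
  · exact ⟨0, by rw [weightProj_apply_of_notMem h hx, zero_smul]⟩

variable (H) in
theorem weightSpace_induction {p : g → Prop}
    (hw : ∀ (χ : Weight ℂ H g), ∀ x ∈ genWeightSpace g χ, p x) (h0 : p 0)
    (hadd : ∀ x y, p x → p y → p (x + y)) (x : g) : p x :=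
  LieSubmodule.iSup_induction (motive := p) (fun χ : Weight ℂ H g => genWeightSpace g χ)
    (by rw [iSup_genWeightSpace_eq_top' ℂ H g]; trivial) hw h0 hadd

theorem root_neg_index (hχ : χ ∈ H.root) (hχ' : -χ ∈ H.root) :
    letI := (IsKilling.rootSystem H).indexNeg
    (⟨-χ, hχ'⟩ : H.root) = -⟨χ, hχ⟩ := by
  let _ := (IsKilling.rootSystem H).indexNeg
  apply (IsKilling.rootSystem H).root.injective
  rw [RootPairing.indexNeg_neg, RootPairing.root_reflectionPerm, RootPairing.reflection_apply_self]
  simp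

theorem neg_mem_root (hχ : χ ∈ H.root) : -χ ∈ H.root := by
  simpa using hχ

theorem neg_notMem_posRoots (hχ : χ ∈ posRoots Γ) : -χ ∉ posRoots Γ := by
  obtain ⟨h, hp⟩ := hχ
  rintro ⟨h', hp'⟩
  rw [root_neg_index h h'] at hp'
  exact (RootPairing.Base.IsPos.neg_iff_not Γ _).1 hp' hp

theorem not_isZero_of_mem_posRoots (hχ : χ ∈ posRoots Γ) : χ ∉ zeroWeights H := by
  obtain ⟨h, -⟩ := hχ
  simpa [zeroWeights] using h

theorem not_isZero_of_mem_negRoots (hχ : χ ∈ negRoots Γ) : χ ∉ zeroWeights H := by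
  have := not_isZero_of_mem_posRoots hχ
  simpa [zeroWeights] using this

theorem notMem_negRoots (hχ : χ ∈ posRoots Γ) : χ ∉ negRoots Γ := neg_notMem_posRoots hχ

theorem notMem_posRoots (hχ : χ ∈ negRoots Γ) : χ ∉ posRoots Γ := fun h =>
  notMem_negRoots h hχ

variable (Γ χ) in
theorem weight_trichotomy : χ ∈ zeroWeights H ∨ χ ∈ posRoots Γ ∨ χ ∈ negRoots Γ := by
  by_cases h : χ.IsZero
  · exact Or.inl h
  · have hr : χ ∈ H.root := by simpa using h
    refine Or.inr ((RootPairing.Base.IsPos.or_neg Γ ⟨χ, hr⟩).imp (fun hp => ⟨hr, hp⟩) fun hp => ?_)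
    rw [← root_neg_index hr (neg_mem_root hr)] at hp
    exact ⟨_, hp⟩

theorem posRoots_add (h₁ : χ₁ ∈ posRoots Γ) (h₂ : χ₂ ∈ posRoots Γ)
    (h : (χ : H → ℂ) = χ₁ + χ₂) : χ ∈ posRoots Γ := by
  by_cases h0 : χ.IsZero
  · have : χ₂ = -χ₁ := Weight.ext fun x => by
      have h0' : (χ : H → ℂ) = 0 := h0
      have := congrFun (h.symm.trans h0') x
      simp only [Pi.add_apply, Pi.zero_apply] at this
      simpa using eq_neg_of_add_eq_zero_right this
    exact absurd (this ▸ h₂) (neg_notMem_posRoots h₁)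
  · obtain ⟨hr₁, hp₁⟩ := h₁
    obtain ⟨hr₂, hp₂⟩ := h₂
    have hr : χ ∈ H.root := by simpa using h0
    refine ⟨hr, hp₁.add hp₂ ?_⟩
    ext x
    simpa using congrFun h x

theorem negRoots_add (h₁ : χ₁ ∈ negRoots Γ) (h₂ : χ₂ ∈ negRoots Γ)
    (h : (χ : H → ℂ) = χ₁ + χ₂) : χ ∈ negRoots Γ :=
  posRoots_add (χ := -χ) h₁ h₂ (by simp [h, add_comm])

theorem mem_zeroWeights_iff : χ ∈ zeroWeights H ↔ (χ : H → ℂ) = 0 := Iff.rfl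

/-- The root spaces for `α` and `β` are orthogonal, unless `α + β = 0`. -/
theorem InvariantForm.apply_eq_zero (B : InvariantForm g) (h : (χ₁ : H → ℂ) + χ₂ ≠ 0) {x y : g}
    (hx : x ∈ genWeightSpace g χ₁) (hy : y ∈ genWeightSpace g χ₂) : B.form x y = 0 := by
  obtain ⟨t, ht⟩ := Function.ne_iff.1 h
  have hx' := IsKilling.lie_eq_smul_of_mem_rootSpace hx t
  have hy' := IsKilling.lie_eq_smul_of_mem_rootSpace hy t
  have hi := B.invariant t x y
  change B.form ⁅t, x⁆ y = -B.form x ⁅t, y⁆ at hi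
  rw [hx', hy'] at hi
  have : (χ₁ t + χ₂ t) * B.form x y = 0 := by
    simp only [map_smul, LinearMap.smul_apply, smul_eq_mul] at hi
    rw [add_mul, hi, neg_add_cancel]
  exact (mul_eq_zero.1 this).resolve_left ht

variable (Γ) in
/-- The operator `½ P₀ + P₋` of the triangular decomposition; it corresponds to the tensor `r`. -/
def rOp : g →ₗ[ℂ] g :=
  (1 / 2 : ℂ) • weightProj H (zeroWeights H) + weightProj H (negRoots Γ)

variable (Γ) in
theorem exists_rOp_eq_smul {x : g} (hx : x ∈ genWeightSpace g χ) :
    ∃ c : ℂ, rOp Γ x = c • x := by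
  obtain ⟨c, hc⟩ := exists_weightProj_eq_smul (zeroWeights H) hx
  obtain ⟨c', hc'⟩ := exists_weightProj_eq_smul (negRoots Γ) hx
  exact ⟨1 / 2 * c + c', by simp [rOp, hc, hc', add_smul, mul_smul]⟩

theorem rOp_of_zero (hχ : χ ∈ zeroWeights H) {x : g} (hx : x ∈ genWeightSpace g χ) :
    rOp Γ x = (1 / 2 : ℂ) • x := by
  simp [rOp, weightProj_apply_of_mem hχ hx,
    weightProj_apply_of_notMem (fun h => not_isZero_of_mem_negRoots h hχ : χ ∉ negRoots Γ) hx]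

theorem rOp_of_pos (hχ : χ ∈ posRoots Γ) {x : g} (hx : x ∈ genWeightSpace g χ) :
    rOp Γ x = 0 := by
  simp [rOp, weightProj_apply_of_notMem (not_isZero_of_mem_posRoots hχ) hx,
    weightProj_apply_of_notMem (notMem_negRoots hχ) hx]

theorem rOp_of_neg (hχ : χ ∈ negRoots Γ) {x : g} (hx : x ∈ genWeightSpace g χ) :
    rOp Γ x = x := by
  simp [rOp, weightProj_apply_of_notMem (not_isZero_of_mem_negRoots hχ) hx,
    weightProj_apply_of_mem hχ hx]

variable (Γ) in
theorem weightProj_sum (x : g) : weightProj H (zeroWeights H) x + weightProj H (posRoots Γ) x +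
    weightProj H (negRoots Γ) x = x := by
  induction x using weightSpace_induction H with
  | hw χ x hx =>
    rcases weight_trichotomy Γ χ with h | h | h
    · rw [weightProj_apply_of_mem h hx,
        weightProj_apply_of_notMem (fun h' => not_isZero_of_mem_posRoots h' h) hx,
        weightProj_apply_of_notMem (fun h' => not_isZero_of_mem_negRoots h' h) hx]
      simp
    · rw [weightProj_apply_of_mem h hx,
        weightProj_apply_of_notMem (not_isZero_of_mem_posRoots h) hx,
        weightProj_apply_of_notMem (notMem_negRoots h) hx]
      simp
    · rw [weightProj_apply_of_mem h hx,
        weightProj_apply_of_notMem (not_isZero_of_mem_negRoots h) hx,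
        weightProj_apply_of_notMem (notMem_posRoots h) hx]
      simp
  | h0 => simp
  | hadd x y hx hy =>
    rw [map_add, map_add, map_add]
    conv_rhs => rw [← hx, ← hy]
    abel

variable (Γ) in
theorem sub_rOp (x : g) : x - rOp Γ x =
    (1 / 2 : ℂ) • weightProj H (zeroWeights H) x + weightProj H (posRoots Γ) x := by
  have h := weightProj_sum Γ x
  have e : (1 / 2 : ℂ) • weightProj H (zeroWeights H) x +
      (1 / 2 : ℂ) • weightProj H (zeroWeights H) x = weightProj H (zeroWeights H) x := by
    rw [← add_smul]; norm_num
  rw [rOp, LinearMap.add_apply, LinearMap.smul_apply, sub_eq_iff_eq_add]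
  nth_rw 1 [← h]
  nth_rw 1 [← e]
  abel

theorem lie_eq_zero_of_zeroWeights (h₁ : χ₁ ∈ zeroWeights H) (h₂ : χ₂ ∈ zeroWeights H) {x y : g}
    (hx : x ∈ genWeightSpace g χ₁) (hy : y ∈ genWeightSpace g χ₂) : ⁅x, y⁆ = 0 := by
  rw [mem_zeroWeights_iff.1 h₁] at hx
  have hx' : x ∈ H.toLieSubmodule := rootSpace_zero_eq ℂ g H ▸ hx
  have := IsKilling.lie_eq_smul_of_mem_rootSpace hy ⟨x, hx'⟩
  rw [mem_zeroWeights_iff.1 h₂, Pi.zero_apply, zero_smul] at this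
  exact this

variable (Γ) in
/-- On weight vectors, on which `rOp` has the eigenvalues `½`, `0`, `1`, the identity expresses that
the three parts of the triangular decomposition are subalgebras, that `𝔥` normalizes the other two,
and that `𝔥` is abelian. -/
theorem rOp_rotaBaxter (x y : g) :
    ⁅rOp Γ x, rOp Γ y⁆ = rOp Γ (⁅rOp Γ x, y⁆ + ⁅x, rOp Γ y⁆ - ⁅x, y⁆) := by
  induction x using weightSpace_induction H with
  | h0 => simp
  | hadd x x' h h' => simp only [map_add, add_lie, map_sub] at *; rw [h, h']; abel
  | hw χ₁ x hx =>
  induction y using weightSpace_induction H with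
  | h0 => simp
  | hadd x x' h h' => simp only [map_add, lie_add, map_sub] at *; rw [h, h']; abel
  | hw χ₂ y hy =>
  by_cases h0 : ⁅x, y⁆ = 0
  · obtain ⟨c, hc⟩ := exists_rOp_eq_smul Γ hx
    obtain ⟨c', hc'⟩ := exists_rOp_eq_smul Γ hy
    simp [hc, hc', h0]
  -- Otherwise the sum of the weights is a weight.
  have hxy : ⁅x, y⁆ ∈ genWeightSpace g ((χ₁ : H → ℂ) + (χ₂ : H → ℂ)) :=
    lie_mem_genWeightSpace_of_mem_genWeightSpace hx hy
  let χ : Weight ℂ H g := ⟨(χ₁ : H → ℂ) + (χ₂ : H → ℂ),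
    fun h => h0 (by rw [h] at hxy; simpa using hxy)⟩
  have hχ : (χ : H → ℂ) = χ₁ + χ₂ := rfl
  have hχ' : ⁅x, y⁆ ∈ genWeightSpace g χ := hxy
  have left : χ₁ ∈ zeroWeights H → χ = χ₂ := fun h => Weight.ext fun t => by
    simp [hχ, mem_zeroWeights_iff.1 h]
  have right : χ₂ ∈ zeroWeights H → χ = χ₁ := fun h => Weight.ext fun t => by
    simp [hχ, mem_zeroWeights_iff.1 h]
  rcases weight_trichotomy Γ χ₁ with h₁ | h₁ | h₁ <;>
  rcases weight_trichotomy Γ χ₂ with h₂ | h₂ | h₂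
  · exact absurd (lie_eq_zero_of_zeroWeights h₁ h₂ hx hy) h0
  · simp [rOp_of_zero h₁ hx, rOp_of_pos h₂ hy, rOp_of_pos (left h₁ ▸ h₂) hχ']
  · simp [rOp_of_zero h₁ hx, rOp_of_neg h₂ hy, rOp_of_neg (left h₁ ▸ h₂) hχ']
  · simp [rOp_of_pos h₁ hx, rOp_of_zero h₂ hy, rOp_of_pos (right h₂ ▸ h₁) hχ']
  · simp [-lie_skew, rOp_of_pos h₁ hx, rOp_of_pos h₂ hy, rOp_of_pos (posRoots_add h₁ h₂ hχ) hχ']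
  · simp [rOp_of_pos h₁ hx, rOp_of_neg h₂ hy]
  · simp [rOp_of_neg h₁ hx, rOp_of_zero h₂ hy, rOp_of_neg (right h₂ ▸ h₁) hχ']
  · simp [rOp_of_neg h₁ hx, rOp_of_pos h₂ hy]
  · simp [rOp_of_neg h₁ hx, rOp_of_neg h₂ hy, rOp_of_neg (negRoots_add h₁ h₂ hχ) hχ']

/-- The projections to opposite sums of weight spaces are adjoint to each other. -/
theorem weightProj_adjoint (B : InvariantForm g) {s s' : Set (Weight ℂ H g)}
    (hs : ∀ χ, χ ∈ s ↔ -χ ∈ s') (x y : g) :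
    B.form (weightProj H s x) y = B.form x (weightProj H s' y) := by
  induction x using weightSpace_induction H with
  | h0 => simp
  | hadd x x' h h' => simp only [map_add, LinearMap.add_apply, h, h']
  | hw χ₁ x hx =>
  induction y using weightSpace_induction H with
  | h0 => simp
  | hadd x x' h h' => simp only [map_add, h, h']
  | hw χ₂ y hy =>
  by_cases h : (χ₁ : H → ℂ) + χ₂ = 0
  · have : χ₂ = -χ₁ := Weight.ext fun t => by
      simpa using eq_neg_of_add_eq_zero_right (congrFun h t)
    subst this
    by_cases h₁ : χ₁ ∈ s
    · rw [weightProj_apply_of_mem h₁ hx, weightProj_apply_of_mem ((hs _).1 h₁) hy]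
    · rw [weightProj_apply_of_notMem h₁ hx,
        weightProj_apply_of_notMem (fun h => h₁ ((hs _).2 h)) hy]
      simp
  · have h0 := B.apply_eq_zero h hx hy
    obtain ⟨c, hc⟩ := exists_weightProj_eq_smul s hx
    obtain ⟨c', hc'⟩ := exists_weightProj_eq_smul s' hy
    simp [hc, hc', h0]

theorem zeroWeights_neg (χ : Weight ℂ H g) : χ ∈ zeroWeights H ↔ -χ ∈ zeroWeights H := by
  simp [zeroWeights]

theorem negRoots_neg (χ : Weight ℂ H g) : χ ∈ negRoots Γ ↔ -χ ∈ posRoots Γ := Iff.rfl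

theorem posRoots_neg (χ : Weight ℂ H g) : χ ∈ posRoots Γ ↔ -χ ∈ negRoots Γ := by
  rw [negRoots_neg, neg_neg]

variable (Γ) in
theorem rOp_adjoint (B : InvariantForm g) (x y : g) :
    B.form (rOp Γ x) y = B.form x (y - rOp Γ y) := by
  rw [sub_rOp, rOp]
  simp only [LinearMap.add_apply, LinearMap.smul_apply, map_add, map_smul,
    weightProj_adjoint B zeroWeights_neg, weightProj_adjoint B negRoots_neg]

theorem InvariantForm.comm (B : InvariantForm g) (x y : g) : B.form x y = B.form y x :=
  B.symm.eq x y

theorem InvariantForm.exists_eq (B : InvariantForm g) (Φ : Module.Dual ℂ g) :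
    ∃ u, Φ = B.form u :=
  ⟨(B.form.toDual B.nondegenerate).symm Φ, by
    ext x
    exact (LinearMap.BilinForm.apply_toDual_symm_apply (hB := B.nondegenerate) Φ x).symm⟩

theorem InvariantForm.eq_of_forall (B : InvariantForm g) {u v : g}
    (h : ∀ x, B.form u x = B.form v x) : u = v :=
  (B.form.toDual B.nondegenerate).injective (LinearMap.ext h)

/-- The basis that is dual to `Module.finBasis ℂ g`. -/
def InvariantForm.coBasis (B : InvariantForm g) :
    Module.Basis (Fin (Module.finrank ℂ g)) ℂ g :=
  B.form.dualBasis B.nondegenerate (Module.finBasis ℂ g)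

theorem InvariantForm.sum_basis_coBasis (B : InvariantForm g) (u : g) :
    ∑ i, B.form u (Module.finBasis ℂ g i) • B.coBasis i = u := by
  have h := B.coBasis.sum_repr u
  simp only [coBasis, LinearMap.BilinForm.dualBasis_repr_apply] at h
  exact h

theorem InvariantForm.sum_coBasis_basis (B : InvariantForm g) (v : g) :
    ∑ i, B.form v (B.coBasis i) • Module.finBasis ℂ g i = v := by
  refine B.eq_of_forall fun x => ?_
  simp only [map_sum, map_smul, LinearMap.sum_apply, LinearMap.smul_apply, smul_eq_mul]
  conv_rhs => rw [← B.sum_basis_coBasis x]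
  simp only [map_sum, map_smul, smul_eq_mul]
  exact Finset.sum_congr rfl fun i _ => by rw [mul_comm, B.comm x]

/-! ### The tensor `r` and the Manin complement -/

/-- Evaluation of a tensor at two functionals. -/
def tensorEval (Φ Ψ : Module.Dual ℂ g) : g ⊗[ℂ] g →ₗ[ℂ] ℂ :=
  LinearMap.mul' ℂ ℂ ∘ₗ TensorProduct.map Φ Ψ

theorem tensorEval_tmul (Φ Ψ : Module.Dual ℂ g) (x y : g) :
    tensorEval Φ Ψ (x ⊗ₜ y) = Φ x * Ψ y := by simp [tensorEval]

theorem tensorEval_map (Φ Ψ : Module.Dual ℂ g) (P Q : g →ₗ[ℂ] g) (τ : g ⊗[ℂ] g) :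
    tensorEval Φ Ψ (TensorProduct.map P Q τ) = tensorEval (Φ ∘ₗ P) (Ψ ∘ₗ Q) τ := by
  induction τ with
  | zero => simp
  | tmul x y => simp [tensorEval_tmul]
  | add x y h h' => simp only [map_add, h, h']

theorem tensorEval_comm (Φ Ψ : Module.Dual ℂ g) (τ : g ⊗[ℂ] g) :
    tensorEval Φ Ψ (TensorProduct.comm ℂ g g τ) = tensorEval Ψ Φ τ := by
  induction τ with
  | zero => simp
  | tmul x y => simp [tensorEval_tmul, mul_comm]
  | add x y h h' => simp only [map_add, h, h']

theorem sum_comp {ι : Type*} [Fintype ι] (e : Module.Basis ι ℂ g) (τ : g ⊗[ℂ] g)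
    (Φ Ψ : Module.Dual ℂ g) :
    ∑ μ, ∑ ν, comp e τ μ ν * (Φ (e μ) * Ψ (e ν)) = tensorEval Φ Ψ τ := by
  conv_rhs => rw [← (e.tensorProduct e).sum_repr τ]
  simp only [map_sum, map_smul, Fintype.sum_prod_type, Module.Basis.tensorProduct_apply,
    tensorEval_tmul, smul_eq_mul, comp]

theorem tensorEval_casimirTensor (B : InvariantForm g) (u v : g) :
    tensorEval (B.form u) (B.form v) (casimirTensor B) = B.form v u := by
  conv_rhs => rw [← B.sum_basis_coBasis u]
  simp only [casimirTensor, map_sum, tensorEval_tmul, map_smul, smul_eq_mul]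
  rfl

variable (Γ) in
/-- The tensor `r` corresponds to the operator `rOp`. -/
theorem tensorEval_rTensor (B : InvariantForm g) (u v : g) :
    tensorEval (B.form u) (B.form v) (rTensor Γ B) = B.form v (rOp Γ u) := by
  have h₁ : ∀ {s s' : Set (Weight ℂ H g)} (hs : ∀ χ, χ ∈ s ↔ -χ ∈ s') (u : g),
      B.form u ∘ₗ weightProj H s' = B.form (weightProj H s u) := fun hs u =>
    LinearMap.ext fun x => (weightProj_adjoint B hs u x).symm
  have h₂ : ∀ (s : Set (Weight ℂ H g)) (u : g), weightProj H s (weightProj H s u) =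
      weightProj H s u := fun s u =>
    Submodule.projection_apply_of_mem_left _ (Submodule.projection_apply_mem _ _)
  rw [rTensor, map_add, map_smul, tensorEval_map, tensorEval_map, h₁ zeroWeights_neg,
    h₁ zeroWeights_neg, h₁ negRoots_neg, h₁ posRoots_neg, tensorEval_casimirTensor,
    tensorEval_casimirTensor, weightProj_adjoint B zeroWeights_neg,
    weightProj_adjoint B posRoots_neg, h₂, h₂]
  simp [rOp]

theorem tensorEval_rSym (B : InvariantForm g) (u v : g) :
    tensorEval (B.form u) (B.form v) (rSym Γ B) = 1 / 2 * B.form v u := by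
  rw [rSym, map_smul, map_add, tensorEval_comm, tensorEval_rTensor, tensorEval_rTensor,
    B.comm u, rOp_adjoint, map_sub, smul_eq_mul]
  ring

theorem tensorEval_rAlt (B : InvariantForm g) (u v : g) :
    tensorEval (B.form u) (B.form v) (rAlt Γ B) = B.form v (rOp Γ u) - 1 / 2 * B.form v u := by
  rw [rAlt, map_smul, map_sub, tensorEval_comm, tensorEval_rTensor, tensorEval_rTensor,
    B.comm u, rOp_adjoint, map_sub, smul_eq_mul]
  ring

variable (H) in
theorem weightSum_zeroWeights : weightSum H (zeroWeights H) = H.toSubmodule := by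
  apply le_antisymm
  · refine iSup₂_le fun χ hχ x hx => ?_
    rw [mem_zeroWeights_iff.1 hχ] at hx
    have hx' : x ∈ rootSpace H (0 : H → ℂ) := hx
    rw [rootSpace_zero_eq ℂ g H] at hx'
    exact hx'
  · intro x hx
    have hx' : x ∈ rootSpace H (0 : H → ℂ) := by
      rw [rootSpace_zero_eq ℂ g H]; exact hx
    by_cases h : rootSpace H (0 : H → ℂ) = ⊥
    · rw [h] at hx'
      rw [(LieSubmodule.mem_bot x).1 hx']
      exact zero_mem _
    · exact mem_weightSum (χ := ⟨0, h⟩) (mem_zeroWeights_iff.2 rfl) hx'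

theorem weightProj_of_mem_weightSum {s t : Set (Weight ℂ H g)} (h : Disjoint s t) {x : g}
    (hx : x ∈ weightSum H s) : weightProj H t x = 0 :=
  (Submodule.projection_apply_eq_zero_iff _).2
    ((biSup_mono fun _ hχ => Set.disjoint_left.1 h hχ :
      weightSum H s ≤ weightSum H tᶜ) hx)

/-- The Manin complement is `{(ρ z, ρ z - z) | z ∈ g}` for `ρ = rOp Γ`; an element is determined by
the difference `z` of its components. -/
theorem mem_maninComplement_iff {m : g × g} :
    m ∈ maninComplement Γ ↔ m.1 = rOp Γ (m.1 - m.2) := by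
  have dp : Disjoint (zeroWeights H) (posRoots Γ) :=
    Set.disjoint_right.2 fun _ => not_isZero_of_mem_posRoots
  have dm : Disjoint (zeroWeights H) (negRoots Γ) :=
    Set.disjoint_right.2 fun _ => not_isZero_of_mem_negRoots
  have d : Disjoint (posRoots Γ) (negRoots Γ) :=
    Set.disjoint_left.2 fun _ => notMem_negRoots
  have mem : ∀ (s : Set (Weight ℂ H g)) x, weightProj H s x ∈ weightSum H s := fun s x =>
    Submodule.projection_apply_mem _ _
  constructor
  · rintro ⟨h₁, h₂, h₀⟩
    rw [bMinus, ← weightSum_zeroWeights] at h₁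
    rw [bPlus, ← weightSum_zeroWeights] at h₂
    have e₁ : weightProj H (posRoots Γ) m.1 = 0 := by
      obtain ⟨y, hy, z, hz, h⟩ := Submodule.mem_sup.1 h₁
      rw [← h, map_add, weightProj_of_mem_weightSum dp hy, weightProj_of_mem_weightSum d.symm hz,
        add_zero]
    have e₂ : weightProj H (negRoots Γ) m.2 = 0 := by
      obtain ⟨y, hy, z, hz, h⟩ := Submodule.mem_sup.1 h₂
      rw [← h, map_add, weightProj_of_mem_weightSum dm hy, weightProj_of_mem_weightSum d hz,
        add_zero]
    have e₃ := weightProj_sum Γ m.1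
    rw [e₁, add_zero] at e₃
    rw [rOp, LinearMap.add_apply, LinearMap.smul_apply, map_sub, map_sub, e₂,
      eq_neg_of_add_eq_zero_right h₀, sub_neg_eq_add, sub_zero, ← two_smul ℂ, smul_smul]
    norm_num [e₃]
  · intro h
    set z := m.1 - m.2 with hz
    have h₂ : m.2 = -(z - rOp Γ z) := by rw [← h, hz]; abel
    refine ⟨?_, ?_, ?_⟩
    · rw [h, bMinus, ← weightSum_zeroWeights]
      exact Submodule.add_mem_sup (Submodule.smul_mem _ _ (mem _ _)) (mem _ _)
    · rw [h₂, sub_rOp, bPlus, ← weightSum_zeroWeights]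
      exact neg_mem (Submodule.add_mem_sup (Submodule.smul_mem _ _ (mem _ _)) (mem _ _))
    · rw [h₂, map_neg, h, sub_rOp, rOp, LinearMap.add_apply, LinearMap.smul_apply, map_add, map_add,
        weightProj_of_mem_weightSum dp.symm (mem _ _),
        weightProj_of_mem_weightSum dm.symm (mem _ _)]
      simp

end Triangular

/-! ### Derivatives along one-parameter groups -/

section Exponential

attribute [local instance] Matrix.linftyOpNormedRing Matrix.linftyOpNormedAlgebra

variable {V W : Type*} [AddCommGroup V] [Module ℂ V] [FiniteDimensional ℂ V]
  [NormedAddCommGroup W] [NormedSpace ℂ W]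

theorem endExp_smul (A : Module.End ℂ V) (t : ℂ) : endExp (t • A) =
    (LinearMap.toMatrixAlgEquiv (Module.finBasis ℂ V)).symm
      (exp (t • LinearMap.toMatrixAlgEquiv (Module.finBasis ℂ V) A)) := by
  rw [endExp, map_smul]

theorem hasDerivAt_exp_smul_zero {n : Type*} [Fintype n] [DecidableEq n] (N : Matrix n n ℂ) :
    HasDerivAt (fun t : ℂ => exp (t • N)) N 0 :=
  (hasDerivAt_exp_smul_const (𝕂 := ℂ) N 0).congr_deriv (by simp)

theorem hasDerivAt_endExp (A : Module.End ℂ V) (Λ : Module.End ℂ V →ₗ[ℂ] W) :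
    HasDerivAt (fun t : ℂ => Λ (endExp (t • A))) (Λ A) 0 := by
  let T := LinearMap.toMatrixAlgEquiv (Module.finBasis ℂ V)
  have h := (LinearMap.toContinuousLinearMap (Λ ∘ₗ T.symm.toLinearMap)).hasFDerivAt.comp_hasDerivAt
    (0 : ℂ) (hasDerivAt_exp_smul_zero (T A))
  refine (h.congr_deriv ?_).congr_of_eventuallyEq (.of_forall fun t => ?_)
  · change Λ (T.symm (T A)) = Λ A
    rw [AlgEquiv.symm_apply_apply]
  · simp only [endExp_smul]; rfl

/-- The derivative at `t = 0` of an expression that is bilinear in `exp (t A)` and its inverse. -/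
theorem hasDerivAt_endExp_conj (A : Module.End ℂ V)
    (β : Module.End ℂ V →ₗ[ℂ] Module.End ℂ V →ₗ[ℂ] W) :
    HasDerivAt (fun t : ℂ => β (endExp (t • A)) (endExp (-(t • A)))) (β A 1 - β 1 A) 0 := by
  let T := LinearMap.toMatrixAlgEquiv (Module.finBasis ℂ V)
  have h := (β.compl₁₂ T.symm.toLinearMap T.symm.toLinearMap).toContinuousBilinearMap
    |>.hasDerivAt_of_bilinear (fun _ => hasDerivAt_exp_smul_zero (T A))
      (fun _ => hasDerivAt_exp_smul_zero (T (-A)))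
  refine (h.congr_deriv ?_).congr_of_eventuallyEq (.of_forall fun t => ?_)
  · change β (T.symm (exp ((0 : ℂ) • T A))) (T.symm (T (-A))) +
      β (T.symm (T A)) (T.symm (exp ((0 : ℂ) • T (-A)))) = _
    simp [add_comm, sub_eq_add_neg]
  · simp only [endExp_smul, ← smul_neg]; rfl

theorem IsLocalExt.deriv_comp {S : Type*} {ι : S → W} {φ : S → ℂ} {s : S} {F : W → ℂ} {γ : ℂ → S}
    {v : W} (h : IsLocalExt ι φ s F) (h0 : γ 0 = s) (hγ : HasDerivAt (fun t => ι (γ t)) v 0) :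
    deriv (fun t => φ (γ t)) 0 = fderiv ℂ F (ι s) v := by
  subst h0
  have h₁ := (h.analytic.differentiableAt.hasFDerivAt).comp_hasDerivAt (0 : ℂ) hγ
  refine (h₁.congr_of_eventuallyEq ?_).deriv
  filter_upwards [hγ.continuousAt.tendsto.eventually h.eventually] with t ht
  exact ht _ rfl

end Exponential

/-! ### The action of the double on the endomorphisms -/

section Double

variable {g : Type*} [LieRing g] [LieAlgebra ℂ g] [FiniteDimensional ℂ g]

variable (g) in
/-- Linear coordinates on `Module.End ℂ g`. -/
def endCoord : Module.End ℂ g ≃ₗ[ℂ] (Fin (Module.finrank ℂ (Module.End ℂ g)) → ℂ) :=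
  (Module.finBasis ℂ (Module.End ℂ g)).equivFun

variable (g) in
/-- The linear vector fields `A ↦ A ∘ ad x - ad y ∘ A` on `Module.End ℂ g`, in coordinates. On the
group, `(x, y)` acts as the difference of a left-invariant and a right-invariant vector field. -/
def doubleField : g × g →ₗ[ℂ] (Fin (Module.finrank ℂ (Module.End ℂ g)) → ℂ) →L[ℂ]
    (Fin (Module.finrank ℂ (Module.End ℂ g)) → ℂ) :=
  LinearMap.toContinuousLinearMap.toLinearMap ∘ₗ
    (endCoord g).conj.toLinearMap ∘ₗ
      ((LinearMap.mul ℂ (Module.End ℂ g)).flip ∘ₗ (LieAlgebra.ad ℂ g : g →ₗ[ℂ] Module.End ℂ g) ∘ₗ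
        LinearMap.fst ℂ g g -
      LinearMap.mul ℂ (Module.End ℂ g) ∘ₗ (LieAlgebra.ad ℂ g : g →ₗ[ℂ] Module.End ℂ g) ∘ₗ
        LinearMap.snd ℂ g g)

theorem doubleField_apply (z : g × g) (A : Module.End ℂ g) :
    doubleField g z (endCoord g A) =
      endCoord g (A * LieAlgebra.ad ℂ g z.1 - LieAlgebra.ad ℂ g z.2 * A) := by
  simp [doubleField, LinearEquiv.conj_apply]

theorem doubleField_lie (z z' : g × g) (w : Fin (Module.finrank ℂ (Module.End ℂ g)) → ℂ) :
    doubleField g ⁅z, z'⁆ w =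
      doubleField g z' (doubleField g z w) - doubleField g z (doubleField g z' w) := by
  obtain ⟨A, rfl⟩ := (endCoord g).surjective w
  simp only [doubleField_apply, ← map_sub]
  congr 1
  change A * LieAlgebra.ad ℂ g ⁅z.1, z'.1⁆ - LieAlgebra.ad ℂ g ⁅z.2, z'.2⁆ * A = _
  simp only [LieHom.map_lie, Ring.lie_def]
  noncomm_ring

/-- The scalar product of the double, as a bilinear form. -/
def doubleBilin (B : InvariantForm g) : LinearMap.BilinForm ℂ (g × g) :=
  B.form.compl₁₂ (LinearMap.fst ℂ g g) (LinearMap.fst ℂ g g) -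
    B.form.compl₁₂ (LinearMap.snd ℂ g g) (LinearMap.snd ℂ g g)

theorem doubleBilin_apply (B : InvariantForm g) (p q : g × g) :
    doubleBilin B p q = B.form p.1 q.1 - B.form p.2 q.2 := rfl

variable [LieAlgebra.IsSemisimple ℂ g]

theorem doubleBilin_comm (B : InvariantForm g) (x y : g × g) :
    doubleBilin B x y = doubleBilin B y x := by
  rw [doubleBilin_apply, doubleBilin_apply, B.comm x.1, B.comm x.2]

theorem exists_doubleBilin_eq (B : InvariantForm g) (Φ : Module.Dual ℂ (g × g)) :
    ∃ u, Φ = doubleBilin B u := by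
  obtain ⟨u, hu⟩ := B.exists_eq (Φ ∘ₗ LinearMap.inl ℂ g g)
  obtain ⟨v, hv⟩ := B.exists_eq (Φ ∘ₗ LinearMap.inr ℂ g g)
  refine ⟨(u, -v), LinearMap.ext fun x => ?_⟩
  rw [doubleBilin_apply, map_neg, ← hu, LinearMap.neg_apply, ← hv]
  simp [← map_add]

theorem doubleBilin_lie (B : InvariantForm g) (x y z : g × g) :
    doubleBilin B ⁅x, y⁆ z = -doubleBilin B y ⁅x, z⁆ := by
  change B.form ⁅x.1, y.1⁆ z.1 - B.form ⁅x.2, y.2⁆ z.2 =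
    -(B.form y.1 ⁅x.1, z.1⁆ - B.form y.2 ⁅x.2, z.2⁆)
  rw [B.invariant, B.invariant]
  ring

/-! ### Two solutions of the Yang–Baxter equation on the double -/

variable {H : LieSubalgebra ℂ g} [H.IsCartanSubalgebra]
  (Γ : (LieAlgebra.IsKilling.rootSystem H).Base)

/-- The Rota–Baxter operator on the double that gives Sklyanin's bracket. -/
def sklyaninOp : g × g →ₗ[ℂ] g × g := (rOp Γ).prodMap (rOp Γ)

/-- The projection of the double onto the Lagrangian subalgebra `{(x - ρ x, -ρ x)}`, where `ρ` is
`rOp Γ`, along the diagonal. -/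
def maninOp : g × g →ₗ[ℂ] g × g :=
  ((LinearMap.id - rOp Γ).prod (-rOp Γ)) ∘ₗ (LinearMap.fst ℂ g g - LinearMap.snd ℂ g g)

theorem sklyaninOp_apply (x : g × g) : sklyaninOp Γ x = (rOp Γ x.1, rOp Γ x.2) := rfl

theorem maninOp_apply (x : g × g) :
    maninOp Γ x = ((x.1 - x.2) - rOp Γ (x.1 - x.2), -rOp Γ (x.1 - x.2)) := rfl

theorem sklyaninOp_rotaBaxter (x y : g × g) : ⁅sklyaninOp Γ x, sklyaninOp Γ y⁆ =
    sklyaninOp Γ (⁅sklyaninOp Γ x, y⁆ + ⁅x, sklyaninOp Γ y⁆ - ⁅x, y⁆) :=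
  Prod.ext (rOp_rotaBaxter Γ x.1 y.1) (rOp_rotaBaxter Γ x.2 y.2)

theorem maninOp_rotaBaxter (x y : g × g) : ⁅maninOp Γ x, maninOp Γ y⁆ =
    maninOp Γ (⁅maninOp Γ x, y⁆ + ⁅x, maninOp Γ y⁆ - ⁅x, y⁆) := by
  obtain ⟨x₁, x₂⟩ := x
  obtain ⟨y₁, y₂⟩ := y
  have h := rOp_rotaBaxter Γ (x₁ - x₂) (y₁ - y₂)
  set R := rOp Γ
  set a := R (x₁ - x₂) with ha
  set b := R (y₁ - y₂) with hb
  -- The difference of the two components of the argument of `maninOp` on the right.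
  have key : ⁅(x₁ - x₂) - a, y₁⁆ + ⁅x₁, (y₁ - y₂) - b⁆ - ⁅x₁, y₁⁆ -
      (⁅-a, y₂⁆ + ⁅x₂, -b⁆ - ⁅x₂, y₂⁆) =
      -(⁅a, y₁ - y₂⁆ + ⁅x₁ - x₂, b⁆ - ⁅x₁ - x₂, y₁ - y₂⁆) := by
    simp only [lie_sub, sub_lie, neg_lie, lie_neg]
    abel
  refine Prod.ext ?_ ?_
  · change ⁅(x₁ - x₂) - a, (y₁ - y₂) - b⁆ = (⁅(x₁ - x₂) - a, y₁⁆ + ⁅x₁, (y₁ - y₂) - b⁆ - ⁅x₁, y₁⁆ -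
      (⁅-a, y₂⁆ + ⁅x₂, -b⁆ - ⁅x₂, y₂⁆)) - R (⁅(x₁ - x₂) - a, y₁⁆ + ⁅x₁, (y₁ - y₂) - b⁆ - ⁅x₁, y₁⁆ -
      (⁅-a, y₂⁆ + ⁅x₂, -b⁆ - ⁅x₂, y₂⁆))
    rw [key, map_neg, ← h]
    simp only [sub_lie, lie_sub]
    abel
  · change ⁅-a, -b⁆ = -R (⁅(x₁ - x₂) - a, y₁⁆ + ⁅x₁, (y₁ - y₂) - b⁆ - ⁅x₁, y₁⁆ -
      (⁅-a, y₂⁆ + ⁅x₂, -b⁆ - ⁅x₂, y₂⁆))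
    rw [key, map_neg, ← h, neg_lie, lie_neg]

theorem sklyaninOp_adjoint (B : InvariantForm g) (x y : g × g) :
    doubleBilin B (sklyaninOp Γ x) y = doubleBilin B x (y - sklyaninOp Γ y) := by
  simp only [doubleBilin_apply, sklyaninOp_apply, Prod.fst_sub, Prod.snd_sub, rOp_adjoint]

theorem maninOp_adjoint (B : InvariantForm g) (x y : g × g) :
    doubleBilin B (maninOp Γ x) y = doubleBilin B x (y - maninOp Γ y) := by
  simp only [doubleBilin_apply, maninOp_apply, map_sub,
    LinearMap.sub_apply, map_neg, LinearMap.neg_apply, rOp_adjoint]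
  ring

/-- The left factors of the tensor on the double that gives Sklyanin's bracket. -/
def sklyaninLeft (g : Type*) [LieRing g] [LieAlgebra ℂ g] [FiniteDimensional ℂ g] :
    Fin (Module.finrank ℂ g) ⊕ Fin (Module.finrank ℂ g) → g × g :=
  Sum.elim (fun i => (Module.finBasis ℂ g i, 0)) (fun i => (0, Module.finBasis ℂ g i))

/-- The right factors of the tensor on the double that gives Sklyanin's bracket. -/
def sklyaninRight (B : InvariantForm g) :
    Fin (Module.finrank ℂ g) ⊕ Fin (Module.finrank ℂ g) → g × g :=
  Sum.elim (fun i => (rOp Γ (B.coBasis i), 0)) (fun i => (0, -rOp Γ (B.coBasis i)))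

/-- The left factors of the tensor on the double that gives the bracket of `X`: a basis of the
diagonal. -/
def maninLeft (g : Type*) [LieRing g] [LieAlgebra ℂ g] [FiniteDimensional ℂ g] :
    Fin (Module.finrank ℂ g) → g × g :=
  fun i => (Module.finBasis ℂ g i, Module.finBasis ℂ g i)

/-- The right factors of the tensor on the double that gives the bracket of `X`. -/
def maninRight (B : InvariantForm g) : Fin (Module.finrank ℂ g) → g × g :=
  fun i => (B.coBasis i - rOp Γ (B.coBasis i), -rOp Γ (B.coBasis i))

theorem sum_sklyaninRight (B : InvariantForm g) (u : g × g) :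
    ∑ i, doubleBilin B u (sklyaninLeft g i) • sklyaninRight Γ B i = sklyaninOp Γ u := by
  rw [Fintype.sum_sum_type, sklyaninOp_apply]
  conv_rhs => rw [← B.sum_basis_coBasis u.1, ← B.sum_basis_coBasis u.2]
  ext <;> simp [doubleBilin_apply, sklyaninLeft, sklyaninRight, Prod.fst_sum, Prod.snd_sum]

theorem sum_sklyaninLeft (B : InvariantForm g) (v : g × g) :
    ∑ i, doubleBilin B v (sklyaninRight Γ B i) • sklyaninLeft g i = v - sklyaninOp Γ v := by
  have h : ∀ x, ∑ i, B.form x (rOp Γ (B.coBasis i)) • Module.finBasis ℂ g i = x - rOp Γ x := by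
    intro x
    conv_rhs => rw [← B.sum_coBasis_basis (x - rOp Γ x)]
    refine Finset.sum_congr rfl fun i _ => ?_
    rw [B.comm x, rOp_adjoint, B.comm]
  rw [Fintype.sum_sum_type, sklyaninOp_apply]
  ext
  · rw [Prod.fst_sub, ← h]
    simp [doubleBilin_apply, sklyaninLeft, sklyaninRight, Prod.fst_sum]
  · rw [Prod.snd_sub, ← h]
    simp [doubleBilin_apply, sklyaninLeft, sklyaninRight, Prod.snd_sum]

theorem sum_maninRight (B : InvariantForm g) (u : g × g) :
    ∑ i, doubleBilin B u (maninLeft g i) • maninRight Γ B i = maninOp Γ u := by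
  have h := B.sum_basis_coBasis (u.1 - u.2)
  have h' := congrArg (rOp Γ) h
  simp only [map_sum, map_smul] at h'
  rw [maninOp_apply]
  ext
  · simp only [maninLeft, maninRight, doubleBilin_apply, Prod.fst_sum, Prod.smul_fst, smul_sub,
      Finset.sum_sub_distrib, ← LinearMap.sub_apply, ← map_sub, h, h']
  · simp only [maninLeft, maninRight, doubleBilin_apply, Prod.snd_sum, Prod.smul_snd, smul_neg,
      Finset.sum_neg_distrib, ← LinearMap.sub_apply, ← map_sub, h']

theorem sum_maninLeft (B : InvariantForm g) (v : g × g) :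
    ∑ i, doubleBilin B v (maninRight Γ B i) • maninLeft g i = v - maninOp Γ v := by
  have h : ∀ i, doubleBilin B v (maninRight Γ B i) =
      B.form (v.2 + rOp Γ (v.1 - v.2)) (B.coBasis i) := by
    intro i
    have hρ : ∀ x, B.form x (rOp Γ (B.coBasis i)) = B.form (x - rOp Γ x) (B.coBasis i) := by
      intro x
      rw [B.comm x, rOp_adjoint, B.comm]
    simp only [doubleBilin_apply, maninRight, map_sub, map_neg, hρ, map_add, LinearMap.add_apply,
      LinearMap.sub_apply]
    ring
  simp only [h]
  have e : ∑ i, B.form (v.2 + rOp Γ (v.1 - v.2)) (B.coBasis i) • maninLeft g i =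
      (v.2 + rOp Γ (v.1 - v.2), v.2 + rOp Γ (v.1 - v.2)) := by
    ext <;> simp only [maninLeft, Prod.fst_sum, Prod.snd_sum, Prod.smul_fst, Prod.smul_snd,
      B.sum_coBasis_basis]
  rw [e, maninOp_apply]
  ext <;> simp only [Prod.fst_sub, Prod.snd_sub] <;> abel

theorem sklyanin_yangBaxter (B : InvariantForm g) :
    YangBaxter (sklyaninLeft g) (sklyaninRight Γ B) :=
  yangBaxter_of_rotaBaxter (doubleBilin B)
    (fun Φ => (exists_doubleBilin_eq B Φ).imp fun _ h x => by rw [h])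
    (doubleBilin_comm B) (doubleBilin_lie B) (sklyaninOp Γ)
    (sklyaninOp_rotaBaxter Γ) (sklyaninOp_adjoint Γ B) _ _
    (sum_sklyaninRight Γ B) (sum_sklyaninLeft Γ B)

theorem manin_yangBaxter (B : InvariantForm g) :
    YangBaxter (maninLeft g) (maninRight Γ B) :=
  yangBaxter_of_rotaBaxter (doubleBilin B)
    (fun Φ => (exists_doubleBilin_eq B Φ).imp fun _ h x => by rw [h])
    (doubleBilin_comm B) (doubleBilin_lie B) (maninOp Γ)
    (maninOp_rotaBaxter Γ) (maninOp_adjoint Γ B) _ _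
    (sum_maninRight Γ B) (sum_maninLeft Γ B)

theorem contract_sklyanin (B : InvariantForm g) (u : g × g) (Ψ : Module.Dual ℂ (g × g)) :
    contract (sklyaninLeft g) (sklyaninRight Γ B) (doubleBilin B u) Ψ = Ψ (sklyaninOp Γ u) := by
  simp [← sum_sklyaninRight Γ B u, contract]

theorem contract_manin (B : InvariantForm g) (u : g × g) (Ψ : Module.Dual ℂ (g × g)) :
    contract (maninLeft g) (maninRight Γ B) (doubleBilin B u) Ψ = Ψ (maninOp Γ u) := by
  simp [← sum_maninRight Γ B u, contract]

end Double

section Groups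

variable {g : Type*} [LieRing g] [LieAlgebra ℂ g] [FiniteDimensional ℂ g]
  [LieAlgebra.IsSemisimple ℂ g] (B : InvariantForm g)

/-! ### The automorphism groups inside the endomorphisms -/

/-- The inclusion of `Gbar B` into the endomorphisms of `g`. -/
def toEnd : Gbar B →* Module.End ℂ g :=
  (LinearEquiv.automorphismGroup.toLinearMapMonoidHom (R := ℂ) (M := g)).comp (Gbar B).subtype

theorem embInt_eq (h : IntG B) : embInt B h = toEnd B h := rfl

theorem toEnd_mul_inv (σ : Gbar B) : toEnd B σ * toEnd B σ⁻¹ = 1 := by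
  rw [← map_mul, mul_inv_cancel, map_one]

theorem toEnd_inv_mul (σ : Gbar B) : toEnd B σ⁻¹ * toEnd B σ = 1 := by
  rw [← map_mul, inv_mul_cancel, map_one]

theorem toEnd_inv_apply (σ : Gbar B) (x : g) : toEnd B σ⁻¹ (toEnd B σ x) = x :=
  LinearMap.congr_fun (toEnd_inv_mul B σ) x

theorem toEnd_apply_inv (σ : Gbar B) (x : g) : toEnd B σ (toEnd B σ⁻¹ x) = x :=
  LinearMap.congr_fun (toEnd_mul_inv B σ) x

theorem form_toEnd (σ : Gbar B) (x y : g) :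
    B.form (toEnd B σ x) (toEnd B σ y) = B.form x y := σ.2.2.1 x y

theorem form_toEnd_inv (σ : Gbar B) (x y : g) :
    B.form (toEnd B σ⁻¹ x) y = B.form x (toEnd B σ y) := by
  rw [← form_toEnd B σ, toEnd_apply_inv]

theorem toEnd_mul_ad (σ : Gbar B) (x : g) :
    toEnd B σ * LieAlgebra.ad ℂ g x = LieAlgebra.ad ℂ g (toEnd B σ x) * toEnd B σ :=
  LinearMap.ext fun y => σ.2.1 x y

theorem toEnd_expAd (x : g) : toEnd B (expAd B x) = endExp (LieAlgebra.ad ℂ g x) := rfl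

theorem toEnd_expAd_inv (x : g) : toEnd B (expAd B x)⁻¹ = endExp (-LieAlgebra.ad ℂ g x) := rfl

/-- The adjoint with respect to the form is a linear map that sends each element of the group to its
inverse. In particular inversion is a regular map. -/
theorem exists_inversion : ∃ τ : Module.End ℂ g →ₗ[ℂ] Module.End ℂ g,
    ∀ σ : Gbar B, τ (toEnd B σ) = toEnd B σ⁻¹ := by
  let D := B.form.toDual B.nondegenerate
  refine ⟨D.symm.conj.toLinearMap ∘ₗ Module.Dual.transpose, fun σ => LinearMap.ext fun x => ?_⟩
  apply D.injective
  ext y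
  change D (D.symm (Module.Dual.transpose (toEnd B σ) (D x))) y = B.form (toEnd B σ⁻¹ x) y
  rw [LinearEquiv.apply_symm_apply, form_toEnd_inv]
  rfl

/-- The stabilizer `{(x, σ x)}` of a point `σ` of the group in the double is a Lagrangian subspace.
Pull-backs of differentials vanish on it, hence their gradients lie in it. -/
theorem exists_gradient (σ : Gbar B)
    (F : (Fin (Module.finrank ℂ (Module.End ℂ g)) → ℂ) → ℂ) :
    ∃ u, pullDeriv (doubleField g) F (endCoord g (toEnd B σ)) = doubleBilin B (u, toEnd B σ u) := by
  set Φ := pullDeriv (doubleField g) F (endCoord g (toEnd B σ)) with hΦ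
  obtain ⟨u, hu⟩ := B.exists_eq (Φ ∘ₗ LinearMap.inl ℂ g g)
  have h₁ : ∀ x, Φ (x, 0) = B.form u x := fun x => LinearMap.congr_fun hu x
  have h₂ : ∀ x, Φ (0, toEnd B σ x) = -Φ (x, 0) := by
    intro x
    rw [hΦ, pullDeriv_apply, pullDeriv_apply, doubleField_apply, doubleField_apply, ← map_neg]
    simp [← toEnd_mul_ad]
  refine ⟨u, LinearMap.ext fun z => ?_⟩
  obtain ⟨x, y⟩ := z
  have h₃ : ((x, y) : g × g) = (x, 0) + (0, toEnd B σ (toEnd B σ⁻¹ y)) := by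
    rw [toEnd_apply_inv]; simp
  rw [h₃, map_add, h₂, h₁, h₁, ← h₃, doubleBilin_apply, ← form_toEnd B σ u (toEnd B σ⁻¹ y),
    toEnd_apply_inv]
  ring

variable {H : LieSubalgebra ℂ g} [H.IsCartanSubalgebra]
  (Γ : (LieAlgebra.IsKilling.rootSystem H).Base)

theorem doubleBilin_gradient (σ : Gbar B) (u v : g) :
    doubleBilin B (u, toEnd B σ u) (v, toEnd B σ v) = 0 := by
  rw [doubleBilin_apply, form_toEnd, sub_self]

/-- The symmetric part of a tensor with `R + R* = 1` is half the Casimir tensor of the double, which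
vanishes on gradients. -/
theorem sklyanin_skew (σ : Gbar B) (F G : (Fin (Module.finrank ℂ (Module.End ℂ g)) → ℂ) → ℂ) :
    fieldBracket (doubleField g) (sklyaninLeft g) (sklyaninRight Γ B) F G (endCoord g (toEnd B σ)) =
    -fieldBracket (doubleField g) (sklyaninLeft g) (sklyaninRight Γ B) G F
      (endCoord g (toEnd B σ)) := by
  obtain ⟨u, hu⟩ := exists_gradient B σ F
  obtain ⟨v, hv⟩ := exists_gradient B σ G
  rw [fieldBracket, fieldBracket, hu, hv, contract_sklyanin, contract_sklyanin, doubleBilin_comm,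
    sklyaninOp_adjoint, map_sub, doubleBilin_gradient, zero_sub]

theorem manin_skew (σ : Gbar B) (F G : (Fin (Module.finrank ℂ (Module.End ℂ g)) → ℂ) → ℂ) :
    fieldBracket (doubleField g) (maninLeft g) (maninRight Γ B) F G (endCoord g (toEnd B σ)) =
    -fieldBracket (doubleField g) (maninLeft g) (maninRight Γ B) G F
      (endCoord g (toEnd B σ)) := by
  obtain ⟨u, hu⟩ := exists_gradient B σ F
  obtain ⟨v, hv⟩ := exists_gradient B σ G
  rw [fieldBracket, fieldBracket, hu, hv, contract_manin, contract_manin, doubleBilin_comm,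
    maninOp_adjoint, map_sub, doubleBilin_gradient, zero_sub]

/-! ### Invariant vector fields in coordinates -/

theorem expAd_zero_smul (x : g) : expAd B ((0 : ℂ) • x) = 1 := by
  apply Subtype.ext
  apply LinearEquiv.toLinearMap_injective
  change toEnd B (expAd B _) = toEnd B 1
  rw [toEnd_expAd, zero_smul, map_zero, endExp_zero, map_one]

theorem expInt_zero_smul (x : g) : expInt B ((0 : ℂ) • x) = 1 :=
  Subtype.ext (expAd_zero_smul B x)

theorem toEnd_expAd_smul (x : g) (t : ℂ) :
    toEnd B (expAd B (t • x)) = endExp (t • LieAlgebra.ad ℂ g x) := by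
  rw [toEnd_expAd, map_smul]

theorem toEnd_expAd_smul_inv (x : g) (t : ℂ) :
    toEnd B (expAd B (t • x))⁻¹ = endExp (-(t • LieAlgebra.ad ℂ g x)) := by
  rw [toEnd_expAd_inv, map_smul]

theorem hasDerivAt_mul_expAd (k : Gbar B) (x : g) :
    HasDerivAt (fun t : ℂ => endCoord g (toEnd B (k * expAd B (t • x))))
      (doubleField g (x, 0) (endCoord g (toEnd B k))) 0 := by
  simp only [map_mul, toEnd_expAd_smul, doubleField_apply]
  have := hasDerivAt_endExp (LieAlgebra.ad ℂ g x) ((endCoord g).toLinearMap ∘ₗ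
    LinearMap.mulLeft ℂ (toEnd B k))
  simpa using this

theorem hasDerivAt_expAd_mul (k : Gbar B) (x : g) :
    HasDerivAt (fun t : ℂ => endCoord g (toEnd B (expAd B (t • x) * k)))
      (-doubleField g (0, x) (endCoord g (toEnd B k))) 0 := by
  simp only [map_mul, toEnd_expAd_smul, doubleField_apply]
  have := hasDerivAt_endExp (LieAlgebra.ad ℂ g x) ((endCoord g).toLinearMap ∘ₗ
    LinearMap.mulRight ℂ (toEnd B k))
  simpa using this

section

variable {B} {F : (Fin (Module.finrank ℂ (Module.End ℂ g)) → ℂ) → ℂ}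

theorem leftInv_expAd {φ : Gbar B → ℂ} {k : Gbar B}
    (h : IsLocalExt (endCoord g ∘ toEnd B) φ k F) (x : g) :
    leftInv (expAd B) x φ k = pullDeriv (doubleField g) F (endCoord g (toEnd B k)) (x, 0) :=
  h.deriv_comp (by rw [expAd_zero_smul, mul_one]) (hasDerivAt_mul_expAd B k x)

theorem rightInv_expAd {φ : Gbar B → ℂ} {k : Gbar B}
    (h : IsLocalExt (endCoord g ∘ toEnd B) φ k F) (x : g) :
    rightInv (expAd B) x φ k = -pullDeriv (doubleField g) F (endCoord g (toEnd B k)) (0, x) := by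
  rw [pullDeriv_apply, ← map_neg]
  exact h.deriv_comp (by rw [expAd_zero_smul, one_mul]) (hasDerivAt_expAd_mul B k x)

theorem leftInv_expInt {φ : IntG B → ℂ} {k : IntG B}
    (h : IsLocalExt (endCoord g ∘ embInt B) φ k F) (x : g) :
    leftInv (expInt B) x φ k = pullDeriv (doubleField g) F (endCoord g (embInt B k)) (x, 0) :=
  h.deriv_comp (by rw [expInt_zero_smul, mul_one]) (hasDerivAt_mul_expAd B k x)

theorem rightInv_expInt {φ : IntG B → ℂ} {k : IntG B}
    (h : IsLocalExt (endCoord g ∘ embInt B) φ k F) (x : g) :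
    rightInv (expInt B) x φ k = -pullDeriv (doubleField g) F (endCoord g (embInt B k)) (0, x) := by
  rw [pullDeriv_apply, ← map_neg]
  exact h.deriv_comp (by rw [expInt_zero_smul, one_mul]) (hasDerivAt_expAd_mul B k x)

end

/-! ### The Poisson structures on the groups -/

variable {ι : Type*} [Fintype ι] (e : Module.Basis ι ℂ g)

theorem isRestriction_bracketX : IsRestriction (doubleField g) (maninLeft g) (maninRight Γ B)
    (endCoord g ∘ embX B) (bracketX Γ e B) := by
  intro φ ψ x F G hF hG
  obtain ⟨u, hu⟩ := exists_gradient B x F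
  obtain ⟨v, hv⟩ := exists_gradient B x G
  have L : ∀ {φ : X B → ℂ} {F u} (_ : IsLocalExt (endCoord g ∘ embX B) φ x F)
      (_ : pullDeriv (doubleField g) F (endCoord g (toEnd B x)) = doubleBilin B (u, toEnd B x u)) y,
      leftInv (K := Gbar B) (expAd B) y φ x = B.form u y ∧
      rightInv (K := Gbar B) (expAd B) y φ x = B.form (toEnd B x u) y := by
    intro φ F u hF hu y
    have h₁ := leftInv_expAd (B := B) hF y
    have h₂ := rightInv_expAd (B := B) hF y
    rw [hu, doubleBilin_apply] at h₁ h₂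
    simp only [map_zero, sub_zero, zero_sub, neg_neg] at h₁ h₂
    exact ⟨h₁, h₂⟩
  change bracketGbar Γ e B φ ψ x = _
  rw [fieldBracket]
  change _ = contract _ _ (pullDeriv (doubleField g) F (endCoord g (toEnd B x)))
    (pullDeriv (doubleField g) G (endCoord g (toEnd B x)))
  rw [hu, hv, contract_manin]
  unfold bracketGbar
  simp only [(L hF hu _).1, (L hF hu _).2, (L hG hv _).1, (L hG hv _).2,
    ← LinearMap.sub_apply, ← LinearMap.add_apply, ← map_sub, ← map_add, mul_assoc]
  rw [sum_comp, sum_comp, tensorEval_rAlt, tensorEval_rSym, doubleBilin_apply, maninOp_apply]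
  simp only [map_sub, map_add, map_neg, LinearMap.add_apply, LinearMap.sub_apply]
  ring

theorem isRestriction_sklyanin : IsRestriction (doubleField g) (sklyaninLeft g)
    (sklyaninRight Γ B) (endCoord g ∘ embInt B) (sklyaninBracket Γ e B) := by
  intro φ ψ x F G hF hG
  obtain ⟨u, hu⟩ := exists_gradient B x F
  obtain ⟨v, hv⟩ := exists_gradient B x G
  have L : ∀ {φ : IntG B → ℂ} {F u} (_ : IsLocalExt (endCoord g ∘ embInt B) φ x F)
      (_ : pullDeriv (doubleField g) F (endCoord g (toEnd B x)) = doubleBilin B (u, toEnd B x u)) y,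
      leftInv (expInt B) y φ x = B.form u y ∧
      rightInv (expInt B) y φ x = B.form (toEnd B x u) y := by
    intro φ F u hF hu y
    have h₁ := leftInv_expInt hF y
    have h₂ := rightInv_expInt hF y
    rw [embInt_eq, hu, doubleBilin_apply] at h₁ h₂
    simp only [map_zero, sub_zero, zero_sub, neg_neg] at h₁ h₂
    exact ⟨h₁, h₂⟩
  rw [fieldBracket]
  change _ = contract _ _ (pullDeriv (doubleField g) F (endCoord g (toEnd B x)))
    (pullDeriv (doubleField g) G (endCoord g (toEnd B x)))
  rw [hu, hv, contract_sklyanin, sklyaninBracket]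
  simp only [(L hF hu _).1, (L hF hu _).2, (L hG hv _).1, (L hG hv _).2, mul_sub,
    Finset.sum_sub_distrib]
  rw [sum_comp, sum_comp, tensorEval_rTensor, tensorEval_rTensor, doubleBilin_apply,
    sklyaninOp_apply]

variable {B} in
/-- Every restriction of the bracket of the double to a subvariety of the group is Poisson. -/
theorem isPoissonBracket_of_isRestriction {S : Type*} {j : S → Module.End ℂ g}
    {br : FunBracket S} (hj : ∀ s, ∃ σ, j s = toEnd B σ)
    (hbr : IsRestriction (doubleField g) (maninLeft g) (maninRight Γ B) (endCoord g ∘ j) br) :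
    IsPoissonBracket (regularFunctions j) br := by
  rw [← regularFunctions_comp_equiv (endCoord g)]
  refine hbr.isPoissonBracket doubleField_lie (manin_yangBaxter Γ B) fun s F G => ?_
  obtain ⟨σ, hσ⟩ := hj s
  rw [Function.comp_apply, hσ]
  exact manin_skew B Γ σ F G

theorem isPoissonBracket_bracketX :
    IsPoissonBracket (regularFunctions (embX B)) (bracketX Γ e B) :=
  isPoissonBracket_of_isRestriction Γ (fun s => ⟨s, rfl⟩) (isRestriction_bracketX B Γ e)

theorem isPoissonBracket_sklyanin :
    IsPoissonBracket (regularFunctions (embInt B)) (sklyaninBracket Γ e B) := by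
  rw [← regularFunctions_comp_equiv (endCoord g)]
  exact (isRestriction_sklyanin B Γ e).isPoissonBracket doubleField_lie (sklyanin_yangBaxter Γ B)
    fun s F G => sklyanin_skew B Γ s F G

/-- The group with Sklyanin's bracket is a Poisson–Lie group: of the four terms of the bracket of
the product, the two middle ones cancel. -/
theorem isPoissonLieGroup_sklyanin : IsPoissonLieGroup (embInt B) (sklyaninBracket Γ e B) where
  poisson := isPoissonBracket_sklyanin B Γ e
  mul :=
    { regular := fun φ hφ => comp_mem_regularFunctions
        (f := fun p : Module.End ℂ g × Module.End ℂ g => p.1 * p.2)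
        (isPolynomialMap_fst.mul isPolynomialMap_snd)
        (fun p => map_mul (toEnd B) (p.1 : Gbar B) p.2) hφ
      bracket := fun φ _ ψ _ => by
        ext p
        simp only [Function.comp_apply, prodBracket, sklyaninBracket, leftInv, rightInv, mul_assoc,
          ← Finset.sum_add_distrib, ← mul_add]
        simp }

end Groups

section Conjugation

variable {g : Type*} [LieRing g] [LieAlgebra ℂ g] [FiniteDimensional ℂ g]
  [LieAlgebra.IsSemisimple ℂ g] {B : InvariantForm g}

/-! ### Conjugation -/

/-- `j` maps the `Int g`-space `S` equivariantly to `Gbar B` with the action by conjugations. -/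
structure IsConjugationSpace (B : InvariantForm g) {S : Type*} [MulAction (IntG B) S]
    (j : S → Module.End ℂ g) : Prop where
  mem : ∀ s, ∃ σ : Gbar B, j s = toEnd B σ
  smul : ∀ (h : IntG B) s, j (h • s) = toEnd B h * j s * toEnd B (h : Gbar B)⁻¹

theorem isConjugationSpace_embX : IsConjugationSpace B (embX B) :=
  ⟨fun x => ⟨x, rfl⟩, fun _ _ => rfl⟩

theorem isConjugationSpace_embOrbit (x : X B) : IsConjugationSpace B (embOrbit B x) :=
  ⟨fun y => ⟨y.1, rfl⟩, fun _ _ => rfl⟩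

variable {S : Type*} [MulAction (IntG B) S] {j : S → Module.End ℂ g}
  {F : (Fin (Module.finrank ℂ (Module.End ℂ g)) → ℂ) → ℂ} {φ : S → ℂ} {s : S}

theorem IsConjugationSpace.hasDerivAt (hj : IsConjugationSpace B j) (h : IntG B) (s : S) (x : g) :
    HasDerivAt (fun t : ℂ => endCoord g (j ((h * expInt B (t • x)) • s)))
      (-doubleField g (toEnd B h x, toEnd B h x) (endCoord g (j (h • s)))) 0 := by
  let β : Module.End ℂ g →ₗ[ℂ] Module.End ℂ g →ₗ[ℂ] _ :=
    (LinearMap.mul ℂ (Module.End ℂ g)).compl₁₂ (LinearMap.mulLeft ℂ (toEnd B h))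
      (LinearMap.mulLeft ℂ (j s) ∘ₗ LinearMap.mulRight ℂ (toEnd B (h : Gbar B)⁻¹)) |>.compr₂
      (endCoord g).toLinearMap
  have hβ : ∀ P Q, β P Q =
      endCoord g (toEnd B h * P * (j s * (Q * toEnd B (h : Gbar B)⁻¹))) := fun _ _ => rfl
  refine ((hasDerivAt_endExp_conj (LieAlgebra.ad ℂ g x) β).congr_deriv ?_).congr_of_eventuallyEq
    (.of_forall fun t => ?_)
  · rw [hβ, hβ, doubleField_apply, hj.smul, ← map_sub, ← map_neg]
    congr 1
    -- Conjugation by `h` turns `ad x` into `ad (h x)`.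
    have e₁ : LieAlgebra.ad ℂ g x * toEnd B (h : Gbar B)⁻¹ =
        toEnd B (h : Gbar B)⁻¹ * LieAlgebra.ad ℂ g (toEnd B h x) := by
      rw [toEnd_mul_ad, toEnd_inv_apply]
    rw [e₁, toEnd_mul_ad]
    noncomm_ring
  · simp only [hβ]
    rw [hj.smul]
    have e₁ : toEnd B ((h * expInt B (t • x) : IntG B) : Gbar B) =
        toEnd B h * endExp (t • LieAlgebra.ad ℂ g x) := by
      rw [← toEnd_expAd_smul, ← map_mul]; rfl
    have e₂ : toEnd B ((h * expInt B (t • x) : IntG B) : Gbar B)⁻¹ =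
        endExp (-(t • LieAlgebra.ad ℂ g x)) * toEnd B (h : Gbar B)⁻¹ := by
      rw [← toEnd_expAd_smul_inv, ← map_mul, ← mul_inv_rev]; rfl
    rw [e₁, e₂]
    simp only [mul_assoc]

theorem IsConjugationSpace.leftInv (hj : IsConjugationSpace B j) {h : IntG B}
    (hF : IsLocalExt (endCoord g ∘ j) φ (h • s) F) (x : g) :
    leftInv (expInt B) x (fun k => φ (k • s)) h =
      -pullDeriv (doubleField g) F (endCoord g (j (h • s))) (toEnd B h x, toEnd B h x) := by
  rw [pullDeriv_apply, ← map_neg]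
  exact hF.deriv_comp (γ := fun t : ℂ => (h * expInt B (t • x)) • s)
    (by simp only [expInt_zero_smul, mul_one]) (hj.hasDerivAt h s x)

theorem IsConjugationSpace.orbitDeriv (hj : IsConjugationSpace B j)
    (hF : IsLocalExt (endCoord g ∘ j) φ s F) (x : g) :
    orbitDeriv (expInt B) s φ x = -pullDeriv (doubleField g) F (endCoord g (j s)) (x, x) := by
  have h := hj.leftInv (h := 1) (s := s) (by rwa [one_smul]) x
  simp only [PoissonHom.leftInv, one_mul, one_smul] at h
  exact h

theorem IsConjugationSpace.rightInv (hj : IsConjugationSpace B j) {h : IntG B}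
    (hF : IsLocalExt (endCoord g ∘ j) φ (h • s) F) (x : g) :
    rightInv (expInt B) x (fun k => φ (k • s)) h =
      -pullDeriv (doubleField g) F (endCoord g (j (h • s))) (x, x) := by
  rw [← hj.orbitDeriv hF]
  simp only [PoissonHom.rightInv, PoissonHom.orbitDeriv, mul_smul]

/-- Conjugation by `h`, in coordinates. -/
def conjCoord (h : Gbar B) : (Fin (Module.finrank ℂ (Module.End ℂ g)) → ℂ) →L[ℂ]
    (Fin (Module.finrank ℂ (Module.End ℂ g)) → ℂ) :=
  LinearMap.toContinuousLinearMap ((endCoord g).conj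
    (LinearMap.mulLeft ℂ (toEnd B h) ∘ₗ LinearMap.mulRight ℂ (toEnd B h⁻¹)))

theorem conjCoord_apply (h : Gbar B) (A : Module.End ℂ g) :
    conjCoord h (endCoord g A) = endCoord g (toEnd B h * A * toEnd B h⁻¹) := by
  simp [conjCoord, LinearEquiv.conj_apply, mul_assoc]

theorem IsConjugationSpace.isLocalExt_conj (hj : IsConjugationSpace B j) {h : IntG B}
    (hF : IsLocalExt (endCoord g ∘ j) φ (h • s) F) :
    IsLocalExt (endCoord g ∘ j) (fun t => φ (h • t)) s (F ∘ conjCoord (h : Gbar B)) := by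
  have e : ∀ t, conjCoord (h : Gbar B) (endCoord g (j t)) = endCoord g (j (h • t)) := fun t => by
    rw [conjCoord_apply, hj.smul]
  refine ⟨?_, ?_⟩
  · refine AnalyticAt.comp ?_ ((conjCoord (h : Gbar B)).analyticAt _)
    rw [Function.comp_apply, e]
    exact hF.analytic
  · have hc := (conjCoord (h : Gbar B)).continuous.tendsto (endCoord g (j s))
    rw [e] at hc
    filter_upwards [hc.eventually hF.eventually] with w hw
    rintro t rfl
    exact hw (h • t) (e t).symm

theorem pullDeriv_conj {h : Gbar B} {A : Module.End ℂ g}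
    (hF : AnalyticAt ℂ F (endCoord g (toEnd B h * A * toEnd B h⁻¹))) (z : g × g) :
    pullDeriv (doubleField g) (F ∘ conjCoord h) (endCoord g A) z =
      pullDeriv (doubleField g) F (endCoord g (toEnd B h * A * toEnd B h⁻¹))
        (toEnd B h z.1, toEnd B h z.2) := by
  rw [← conjCoord_apply] at hF
  rw [pullDeriv_apply, fderiv_comp _ hF.differentiableAt (conjCoord h).differentiableAt,
    ContinuousLinearMap.fderiv, pullDeriv_apply, ContinuousLinearMap.comp_apply, conjCoord_apply,
    doubleField_apply, doubleField_apply, conjCoord_apply]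
  congr 2
  have e₁ : LieAlgebra.ad ℂ g z.1 * toEnd B h⁻¹ =
      toEnd B h⁻¹ * LieAlgebra.ad ℂ g (toEnd B h z.1) := by
    rw [toEnd_mul_ad, toEnd_inv_apply]
  rw [mul_sub, sub_mul, ← mul_assoc (toEnd B h) (LieAlgebra.ad ℂ g z.2), toEnd_mul_ad,
    mul_assoc (toEnd B h), mul_assoc A, e₁]
  simp only [mul_assoc]

variable {H : LieSubalgebra ℂ g} [H.IsCartanSubalgebra]
  (Γ : (LieAlgebra.IsKilling.rootSystem H).Base) {ι : Type*} [Fintype ι] (e : Module.Basis ι ℂ g)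

/-- The action by conjugations is Poisson: under conjugation by `h`, the bracket changes by the
difference of `r` and its conjugate by `h`, which is the value at `h` of Sklyanin's bivector. -/
theorem IsConjugationSpace.isPoissonAction (hj : IsConjugationSpace B j) {br : FunBracket S}
    (hbr : IsRestriction (doubleField g) (maninLeft g) (maninRight Γ B) (endCoord g ∘ j) br) :
    IsPoissonAction (embInt B) (sklyaninBracket Γ e B) j br where
  group := isPoissonLieGroup_sklyanin B Γ e
  poisson := isPoissonBracket_of_isRestriction Γ hj.mem hbr
  act :=
    { regular := fun φ hφ => by
        obtain ⟨τ, hτ⟩ := exists_inversion B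
        refine comp_mem_regularFunctions
          (f := fun p : Module.End ℂ g × Module.End ℂ g => p.1 * p.2 * τ p.1)
          ((isPolynomialMap_fst.mul isPolynomialMap_snd).mul
            (isPolynomialMap_linear (τ ∘ₗ LinearMap.fst ℂ _ (Module.End ℂ g)))) (fun p => ?_) hφ
        rw [hj.smul, ← hτ]
        rfl
      bracket := fun φ hφ ψ hψ => by
        rw [← regularFunctions_comp_equiv (endCoord g)] at hφ hψ
        ext ⟨h, s⟩
        obtain ⟨F, hF⟩ := exists_isLocalExt hφ (h • s)
        obtain ⟨G, hG⟩ := exists_isLocalExt hψ (h • s)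
        have hF' : AnalyticAt ℂ F (endCoord g (j (h • s))) := hF.analytic
        have hG' : AnalyticAt ℂ G (endCoord g (j (h • s))) := hG.analytic
        obtain ⟨σ, hσ⟩ := hj.mem (h • s)
        obtain ⟨u, hu⟩ := exists_gradient B σ F
        obtain ⟨v, hv⟩ := exists_gradient B σ G
        have L : ∀ (K : (Fin (Module.finrank ℂ (Module.End ℂ g)) → ℂ) → ℂ) (w : g),
            AnalyticAt ℂ K (endCoord g (j (h • s))) →
            pullDeriv (doubleField g) K (endCoord g (j (h • s))) =
              doubleBilin B (w, j (h • s) w) →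
            pullDeriv (doubleField g) (K ∘ conjCoord (h : Gbar B)) (endCoord g (j s)) =
              doubleBilin B (toEnd B (h : Gbar B)⁻¹ w,
                toEnd B (h : Gbar B)⁻¹ (j (h • s) w)) := by
          refine fun K w hK hw => LinearMap.ext fun z => ?_
          have key := pullDeriv_conj (h := (h : Gbar B)) (A := j s) (by rwa [← hj.smul]) z
          rw [← hj.smul] at key
          rw [key, hw, doubleBilin_apply, doubleBilin_apply, form_toEnd_inv, form_toEnd_inv]
        have e₀ := hbr _ _ _ _ _ hF hG
        have e₁ := hbr _ _ _ _ _ (hj.isLocalExt_conj hF) (hj.isLocalExt_conj hG)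
        rw [← hσ] at hu hv
        rw [fieldBracket, Function.comp_apply, L F u hF' hu, L G v hG' hv, contract_manin,
          doubleBilin_apply, maninOp_apply] at e₁
        rw [fieldBracket, Function.comp_apply, hu, hv, contract_manin, doubleBilin_apply,
          maninOp_apply] at e₀
        change br φ ψ (h • s) = sklyaninBracket Γ e B (fun k => φ (k • s)) (fun k => ψ (k • s)) h +
          br (fun t => φ (h • t)) (fun t => ψ (h • t)) s
        have D : ∀ w x, doubleBilin B (w, j (h • s) w) (x, x) =
            B.form (w - j (h • s) w) x := fun w x => by
          rw [doubleBilin_apply, map_sub, LinearMap.sub_apply]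
        rw [e₀, e₁, sklyaninBracket]
        simp only [hj.leftInv hF, hj.leftInv hG, hj.rightInv hF, hj.rightInv hG, hu, hv, D,
          ← form_toEnd_inv, neg_mul_neg, mul_sub, Finset.sum_sub_distrib]
        rw [sum_comp, sum_comp, tensorEval_rTensor, tensorEval_rTensor]
        simp only [map_sub, map_neg, LinearMap.sub_apply, form_toEnd_inv, toEnd_apply_inv]
        ring }

/-! ### Orbits -/

/-- The bracket on an orbit: that of arbitrary local extensions to the ambient vector space. -/
def orbitBracket (B : InvariantForm g) (j : S → Module.End ℂ g) : FunBracket S := fun φ ψ s =>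
  fieldBracket (doubleField g) (maninLeft g) (maninRight Γ B)
    (Classical.epsilon (IsLocalExt (endCoord g ∘ j) φ s))
    (Classical.epsilon (IsLocalExt (endCoord g ∘ j) ψ s)) (endCoord g (j s))

/-- The Hamiltonian vector fields are tangent to the orbits, because the left factors of the
bracket span the diagonal of the double. Hence the bracket does not depend on extensions. -/
theorem IsConjugationSpace.isRestriction_orbitBracket (hj : IsConjugationSpace B j) :
    IsRestriction (doubleField g) (maninLeft g) (maninRight Γ B) (endCoord g ∘ j)
      (orbitBracket Γ B j) := by
  have left : ∀ (φ : S → ℂ) (s : S) F F' G, IsLocalExt (endCoord g ∘ j) φ s F →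
      IsLocalExt (endCoord g ∘ j) φ s F' →
      fieldBracket (doubleField g) (maninLeft g) (maninRight Γ B) F G (endCoord g (j s)) =
      fieldBracket (doubleField g) (maninLeft g) (maninRight Γ B) F' G (endCoord g (j s)) := by
    intro φ s F F' G hF hF'
    rw [fieldBracket, fieldBracket, contract, contract]
    refine Finset.sum_congr rfl fun i _ => ?_
    have := (hj.orbitDeriv hF (Module.finBasis ℂ g i)).symm.trans (hj.orbitDeriv hF' _)
    rw [maninLeft, neg_inj.1 this]
  intro φ ψ s F G hF hG
  obtain ⟨σ, hσ⟩ := hj.mem s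
  have hF' := Classical.epsilon_spec (p := IsLocalExt (endCoord g ∘ j) φ s) ⟨F, hF⟩
  have hG' := Classical.epsilon_spec (p := IsLocalExt (endCoord g ∘ j) ψ s) ⟨G, hG⟩
  rw [orbitBracket, Function.comp_apply, left _ _ _ F _ hF' hF, hσ, manin_skew, ← hσ,
    left _ _ _ G _ hG' hG, hσ, manin_skew, neg_neg]

theorem isPoissonMap_orbit (x : X B) :
    IsPoissonMap (regularFunctions (embOrbit B x)) (orbitBracket Γ B (embOrbit B x))
      (regularFunctions (embX B)) (bracketX Γ e B)
      (Subtype.val : MulAction.orbit (IntG B) x → X B) where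
  regular φ hφ := comp_mem_regularFunctions (ι := embX B) (m := Subtype.val) (f := id)
    (isPolynomialMap_linear LinearMap.id) (fun _ => rfl) hφ
  bracket φ hφ ψ hψ := by
    rw [← regularFunctions_comp_equiv (endCoord g)] at hφ hψ
    ext y
    obtain ⟨F, hF⟩ := exists_isLocalExt hφ y.1
    obtain ⟨G, hG⟩ := exists_isLocalExt hψ y.1
    have res : ∀ {φ : X B → ℂ} {F}, IsLocalExt (endCoord g ∘ embX B) φ y.1 F →
        IsLocalExt (endCoord g ∘ embOrbit B x) (φ ∘ Subtype.val) y F := fun h =>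
      ⟨h.analytic, h.eventually.mono fun w hw t ht => hw t.1 ht⟩
    exact (isRestriction_bracketX B Γ e _ _ _ _ _ hF hG).trans
      ((isConjugationSpace_embOrbit x).isRestriction_orbitBracket Γ _ _ _ _ _
        (res hF) (res hG)).symm

theorem isPoissonHomogeneousSpace_orbit (x : X B) :
    IsPoissonHomogeneousSpace (embInt B) (sklyaninBracket Γ e B) (embOrbit B x)
      (orbitBracket Γ B (embOrbit B x)) where
  action := (isConjugationSpace_embOrbit x).isPoissonAction Γ e
    ((isConjugationSpace_embOrbit x).isRestriction_orbitBracket Γ)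
  transitive := inferInstance

end Conjugation

section Lagrangian

variable {g : Type*} [LieRing g] [LieAlgebra ℂ g] [FiniteDimensional ℂ g]
  [LieAlgebra.IsSemisimple ℂ g] {B : InvariantForm g}

/-! ### The Lagrangian subalgebras -/

theorem isLagrangian_graph (σ : Gbar B) : IsLagrangian B (graphSubalgebra B σ) := by
  refine ⟨?_, fun W hW hle p hp => ?_⟩
  · intro p hp q hq
    have hp' : p.1 = toEnd B σ p.2 := hp
    have hq' : q.1 = toEnd B σ q.2 := hq
    rw [doubleForm, hp', hq', form_toEnd, sub_self]
  · -- `(p.1 - σ p.2, 0)` lies in `W` and is orthogonal to the graph, hence is zero.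
    have h : ∀ y, B.form (p.1 - toEnd B σ p.2) (toEnd B σ y) = 0 := by
      intro y
      have hy : ((toEnd B σ y, y) : g × g) ∈ W := hle (show toEnd B σ y = toEnd B σ y from rfl)
      have h₁ := hW p hp _ hy
      rw [doubleForm, ← form_toEnd B σ p.2 y] at h₁
      rw [map_sub, LinearMap.sub_apply]
      exact h₁
    have : p.1 - toEnd B σ p.2 = 0 := B.eq_of_forall fun x => by
      rw [map_zero, LinearMap.zero_apply, ← toEnd_apply_inv B σ x, h]
    exact sub_eq_zero.1 this

theorem ad_injective {x y : g} (h : LieAlgebra.ad ℂ g x = LieAlgebra.ad ℂ g y) : x = y := by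
  have hk : x - y ∈ LieAlgebra.center ℂ g := by
    rw [LieModule.mem_maxTrivSubmodule]
    intro z
    have hz : ⁅x, z⁆ = ⁅y, z⁆ := LinearMap.congr_fun h z
    rw [← lie_skew, sub_lie, hz, sub_self, neg_zero]
  rw [LieAlgebra.center_eq_bot, LieSubmodule.mem_bot] at hk
  exact sub_eq_zero.1 hk

theorem eq_toEnd_of_ad {σ : Gbar B} {x y : g}
    (h : toEnd B σ * LieAlgebra.ad ℂ g y = LieAlgebra.ad ℂ g x * toEnd B σ) :
    x = toEnd B σ y := by
  rw [toEnd_mul_ad] at h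
  have := congrArg (· * toEnd B σ⁻¹) h
  simp only [mul_assoc, toEnd_mul_inv, mul_one] at this
  exact (ad_injective this).symm

variable {S : Type*} [MulAction (IntG B) S] {j : S → Module.End ℂ g} {s : S} {σ : Gbar B}

theorem IsConjugationSpace.eq_of_mem_stabilizerLie (hj : IsConjugationSpace B j)
    (hσ : j s = toEnd B σ) {b : g} (hb : b ∈ stabilizerLie (expInt B) s) : toEnd B σ b = b := by
  have h := hj.hasDerivAt 1 s b
  have hb' : ∀ t : ℂ, expInt B (t • b) • s = s := hb
  simp only [one_mul, one_smul, hb'] at h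
  have h₁ := h.unique (hasDerivAt_const (0 : ℂ) (endCoord g (j s)))
  have h₂ : toEnd B ((1 : IntG B) : Gbar B) b = b := by
    rw [OneMemClass.coe_one, map_one]; rfl
  rw [h₂, neg_eq_zero, doubleField_apply, hσ, LinearEquiv.map_eq_zero_iff, sub_eq_zero] at h₁
  exact (eq_toEnd_of_ad h₁).symm

theorem isLocalExt_linear (l : Module.Dual ℂ (Module.End ℂ g)) (s : S) :
    IsLocalExt (endCoord g ∘ j) (fun t => l (j t)) s
      (l ∘ₗ (endCoord g).symm.toLinearMap : Module.Dual ℂ _) := by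
  refine ⟨analyticAt_dual _ _, .of_forall ?_⟩
  rintro w t rfl
  simp

theorem pullDeriv_linear (l : Module.Dual ℂ (Module.End ℂ g)) (A : Module.End ℂ g) (z : g × g) :
    pullDeriv (doubleField g) (l ∘ₗ (endCoord g).symm.toLinearMap : Module.Dual ℂ _)
      (endCoord g A) z = l (A * LieAlgebra.ad ℂ g z.1 - LieAlgebra.ad ℂ g z.2 * A) := by
  rw [pullDeriv_dual, doubleField_apply]
  simp

theorem linear_mem_regularFunctions (l : Module.Dual ℂ (Module.End ℂ g)) :
    (fun t => l (j t)) ∈ regularFunctions j :=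
  comp_mem_regularFunctions_of_polynomial j (dual_mem_polynomialFunctions l)

/-- Every covector that annihilates the fixed vectors of `σ` is the differential of a matrix
coefficient. -/
theorem exists_linear_of_fixed {σ : Gbar B} {z : g}
    (hz : ∀ b, toEnd B σ b = b → B.form z b = 0) : ∃ l : Module.Dual ℂ (Module.End ℂ g), ∀ b,
      l (toEnd B σ * LieAlgebra.ad ℂ g b - LieAlgebra.ad ℂ g b * toEnd B σ) = -B.form z b := by
  let T : g →ₗ[ℂ] Module.End ℂ g :=
    (LinearMap.mulLeft ℂ (toEnd B σ) - LinearMap.mulRight ℂ (toEnd B σ)) ∘ₗ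
      (LieAlgebra.ad ℂ g : g →ₗ[ℂ] Module.End ℂ g)
  have hT : ∀ b, T b = toEnd B σ * LieAlgebra.ad ℂ g b - LieAlgebra.ad ℂ g b * toEnd B σ :=
    fun _ => rfl
  have h : -B.form z ∈ LinearMap.range T.dualMap := by
    rw [LinearMap.range_dualMap_eq_dualAnnihilator_ker, Submodule.mem_dualAnnihilator]
    intro b hb
    rw [LinearMap.mem_ker, hT, sub_eq_zero] at hb
    rw [LinearMap.neg_apply, hz b (eq_toEnd_of_ad hb).symm, neg_zero]
  obtain ⟨l, hl⟩ := h
  exact ⟨l, fun b => LinearMap.congr_fun hl b⟩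

variable {H : LieSubalgebra ℂ g} [H.IsCartanSubalgebra]
  (Γ : (LieAlgebra.IsKilling.rootSystem H).Base)

/-- The Hamiltonian vector field of `φ`, in terms of the element `m` of the Manin complement that
represents the differential of `φ` on the orbit. -/
theorem IsConjugationSpace.bracket_eq (hj : IsConjugationSpace B j) {br : FunBracket S}
    (hbr : IsRestriction (doubleField g) (maninLeft g) (maninRight Γ B) (endCoord g ∘ j) br)
    {φ ψ : S → ℂ} {F G} (hF : IsLocalExt (endCoord g ∘ j) φ s F)
    (hG : IsLocalExt (endCoord g ∘ j) ψ s G) {m : g × g} (hm : m ∈ maninComplement Γ)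
    (hφ : ∀ b, PoissonHom.orbitDeriv (expInt B) s φ b = doubleForm B m (b, b)) :
    br φ ψ s = pullDeriv (doubleField g) G (endCoord g (j s)) (m.2, m.1) := by
  obtain ⟨σ, hσ⟩ := hj.mem s
  obtain ⟨u, hu⟩ := exists_gradient B σ F
  rw [← hσ] at hu
  have hd : u - j s u = -(m.1 - m.2) := B.eq_of_forall fun b => by
    have := hφ b
    rw [hj.orbitDeriv hF, hu, doubleBilin_apply, doubleForm] at this
    simp only [map_sub, map_neg, LinearMap.sub_apply, LinearMap.neg_apply]
    linear_combination -this
  rw [hbr _ _ _ _ _ hF hG, fieldBracket, Function.comp_apply, hu, contract_manin, maninOp_apply]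
  congr 1
  simp only [hd, map_neg, ← mem_maninComplement_iff.1 hm, neg_neg]
  ext <;> simp

/-- Both inclusions come down to the fact that `(x, y)` in the double acts trivially at `σ` if and
only if `y = σ x`: the Hamiltonian vector field of `φ` is the action of `-(a, a)` if and only if
`(a, a) + (m.2, m.1)` acts trivially. -/
theorem IsConjugationSpace.correspondingSubset_eq (hj : IsConjugationSpace B j)
    {br : FunBracket S}
    (hbr : IsRestriction (doubleField g) (maninLeft g) (maninRight Γ B) (endCoord g ∘ j) br)
    (hσ : j s = toEnd B σ) : correspondingSubset Γ B j br s = {p | p.1 = toEnd B σ p.2} := by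
  have ext : ∀ {φ}, φ ∈ regularFunctions j → ∃ F, IsLocalExt (endCoord g ∘ j) φ s F := by
    intro φ hφ
    rw [← regularFunctions_comp_equiv (endCoord g)] at hφ
    exact exists_isLocalExt hφ s
  ext p
  constructor
  · rintro ⟨a, m, hm, rfl, -, φ, hφ, hd, hH⟩
    obtain ⟨F, hF⟩ := ext hφ
    -- Test the Hamiltonian vector field against all matrix coefficients.
    refine eq_toEnd_of_ad (sub_eq_zero.1
      ((Module.forall_dual_apply_eq_zero_iff ℂ _).1 fun l => ?_))
    have h := hH _ (linear_mem_regularFunctions l)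
    rw [hj.bracket_eq Γ hbr hF (isLocalExt_linear l s) hm hd,
      hj.orbitDeriv (isLocalExt_linear l s), eq_neg_iff_add_eq_zero, ← map_add, hσ,
      pullDeriv_linear, add_comm] at h
    exact h
  · intro hp
    have hp' : p.1 = toEnd B σ p.2 := hp
    have hz : ∀ b, toEnd B σ b = b → B.form (p.1 - p.2) b = 0 := fun b hb => by
      rw [map_sub, LinearMap.sub_apply, hp', ← form_toEnd B σ p.2 b, hb, sub_self]
    obtain ⟨l, hl⟩ := exists_linear_of_fixed hz
    have hz' : rOp Γ (p.1 - p.2) - (rOp Γ (p.1 - p.2) - (p.1 - p.2)) = p.1 - p.2 :=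
      sub_sub_cancel _ _
    have hm : (rOp Γ (p.1 - p.2), rOp Γ (p.1 - p.2) - (p.1 - p.2)) ∈ maninComplement Γ :=
      mem_maninComplement_iff.2 (by rw [hz'])
    have hform : ∀ b, doubleForm B (rOp Γ (p.1 - p.2), rOp Γ (p.1 - p.2) - (p.1 - p.2)) (b, b) =
        B.form (p.1 - p.2) b := fun b => by
      rw [doubleForm, ← LinearMap.sub_apply, ← map_sub, hz']
    have hd : ∀ b, PoissonHom.orbitDeriv (expInt B) s (fun t => l (j t)) b =
        doubleForm B (rOp Γ (p.1 - p.2), rOp Γ (p.1 - p.2) - (p.1 - p.2)) (b, b) := fun b => by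
      rw [hj.orbitDeriv (isLocalExt_linear l s), hσ, pullDeriv_linear, hl, neg_neg, hform]
    refine ⟨p.1 - rOp Γ (p.1 - p.2), _, hm, ?_, fun b hb => ?_, fun t => l (j t),
      linear_mem_regularFunctions l, hd, fun ψ hψ => ?_⟩
    · ext <;> simp
    · rw [hform, hz b (hj.eq_of_mem_stabilizerLie hσ hb)]
    · obtain ⟨G, hG⟩ := ext hψ
      obtain ⟨v, hv⟩ := exists_gradient B σ G
      rw [hj.bracket_eq Γ hbr (isLocalExt_linear l s) hG hm hd, hj.orbitDeriv hG,
        eq_neg_iff_add_eq_zero, ← map_add, hσ, hv, doubleBilin_apply]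
      have e : rOp Γ (p.1 - p.2) - (p.1 - p.2) + (p.1 - rOp Γ (p.1 - p.2)) = p.2 := by abel
      change B.form v (rOp Γ (p.1 - p.2) - (p.1 - p.2) + (p.1 - rOp Γ (p.1 - p.2))) -
        B.form (toEnd B σ v) (rOp Γ (p.1 - p.2) + (p.1 - rOp Γ (p.1 - p.2))) = 0
      rw [e, add_sub_cancel, hp', form_toEnd, sub_self]

end Lagrangian

end

end PoissonHom

open PoissonHom in
theorem theorem4p1 {g : Type*} [LieRing g] [LieAlgebra ℂ g] [FiniteDimensional ℂ g]
    [LieAlgebra.IsSemisimple ℂ g] (B : InvariantForm g)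
    (H : LieSubalgebra ℂ g) [H.IsCartanSubalgebra]
    (Γ : (LieAlgebra.IsKilling.rootSystem H).Base)
    {ι : Type*} [Fintype ι] (e : Module.Basis ι ℂ g) :
    IsPoissonBracket (regularFunctions (embX B)) (bracketX Γ e B) ∧
    IsPoissonAction (embInt B) (sklyaninBracket Γ e B) (embX B) (bracketX Γ e B) ∧
    ∀ x : X B, ∃ br : FunBracket (MulAction.orbit (IntG B) x),
      IsPoissonMap (regularFunctions (embOrbit B x)) br
        (regularFunctions (embX B)) (bracketX Γ e B) Subtype.val ∧
      IsPoissonHomogeneousSpace (embInt B) (sklyaninBracket Γ e B) (embOrbit B x) br ∧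
      ∀ y : MulAction.orbit (IntG B) x,
        IsLagrangian B (graphSubalgebra B y) ∧
        correspondingSubset Γ B (embOrbit B x) br y = (graphSubalgebra B y : Set (g × g)) := by
  refine ⟨isPoissonBracket_bracketX B Γ e,
    isConjugationSpace_embX.isPoissonAction Γ e (isRestriction_bracketX B Γ e), fun x =>
    ⟨orbitBracket Γ B (embOrbit B x), isPoissonMap_orbit Γ e x,
      isPoissonHomogeneousSpace_orbit Γ e x, fun y => ⟨isLagrangian_graph _, ?_⟩⟩⟩
  exact (isConjugationSpace_embOrbit x).correspondingSubset_eq Γ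
    ((isConjugationSpace_embOrbit x).isRestriction_orbitBracket Γ) rfl
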